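/- A homeomorphism $g$ between open subsets of $\mathbb{C}$ is $k$-quasiconformal ($0\le k<1$) if it preserves orientation and has distributional derivatives $\partial_z g,\partial_{\bar z}g\in L^1_{\mathrm{loc}}$ with $|\partial_{\bar z}g|\le k\,|\partial_z g|$ almost everywhere; a self-homeomorphism of the Riemann sphere $\overline{\mathbb{C}}=\mathbb{C}\cup\{\infty\}$ is $k$-quasiconformal if it is so locally in the standard charts $z$ and $1/z$. Let $k\in[0,1)$ and $K:=(1+k)/(1-k)$. Let $f$ be a holomorphic function on the unit disk $\mathbb{D}=\{z\in\mathbb{C}:|z|<1\}$ with $f(0)=0$ and $f'(0)\ne 0$. Suppose that there is a closed disk $B\subset\mathbb{C}\setminus\{0\}$ (possibly of radius $0$) such that $\max_{w,z\in B}\sqrt{|w/z|}\le K$ and $$\frac{zf'(z)}{f(z)}\in B\qquad\text{for all } z\in\mathbb{D}\setminus\{0\}.$$ Then $f$ has a $k$-quasiconformal extension to $\overline{\mathbb{C}}$ fixing $\infty$: there is a $k$-quasiconformal homeomorphism $F:\overline{\mathbb{C}}\to\overline{\mathbb{C}}$ with $F(z)=f(z)$ for all $z\in\mathbb{D}$ and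 $F(\infty)=\infty$. -/

import Mathlib

/-- The Wirtinger derivative `∂φ/∂z = (∂φ/∂x - i ∂φ/∂y) / 2` of a (real) differentiable function. -/
noncomputable def wirtingerDz (φ : ℂ → ℂ) (z : ℂ) : ℂ :=
  (fderiv ℝ φ z 1 - Complex.I * fderiv ℝ φ z Complex.I) / 2

/-- The Wirtinger derivative `∂φ/∂z̄ = (∂φ/∂x + i ∂φ/∂y) / 2` of a (real) differentiable function. -/
noncomputable def wirtingerDzbar (φ : ℂ → ℂ) (z : ℂ) : ℂ :=
  (fderiv ℝ φ z 1 + Complex.I * fderiv ℝ φ z Complex.I) / 2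

/-- `φ` is a test function on `G`: smooth with compact support contained in `G`. -/
def IsPlaneTestFunction (G : Set ℂ) (φ : ℂ → ℂ) : Prop :=
  ContDiff ℝ (⊤ : ℕ∞) φ ∧ HasCompactSupport φ ∧ tsupport φ ⊆ G

/-- `p` is a locally integrable distributional derivative `∂g/∂z` of `g` on `G`. -/
def HasWeakDz (G : Set ℂ) (g p : ℂ → ℂ) : Prop :=
  MeasureTheory.LocallyIntegrableOn p G ∧
    ∀ φ : ℂ → ℂ, IsPlaneTestFunction G φ →
      ∫ z, g z * wirtingerDz φ z = - ∫ z, p z * φ z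

/-- `q` is a locally integrable distributional derivative `∂g/∂z̄` of `g` on `G`. -/
def HasWeakDzbar (G : Set ℂ) (g q : ℂ → ℂ) : Prop :=
  MeasureTheory.LocallyIntegrableOn q G ∧
    ∀ φ : ℂ → ℂ, IsPlaneTestFunction G φ →
      ∫ z, g z * wirtingerDzbar φ z = - ∫ z, q z * φ z

/-- The loop `t ↦ g (z₀ + r e^{it})`, `0 ≤ t ≤ 2π`, has winding number `+1` about `g z₀`:
a continuous branch of `log (g (z₀ + r e^{it}) - g z₀)` increases by `2πi` along it. -/
def WindsOnceAround (g : ℂ → ℂ) (z₀ : ℂ) (r : ℝ) : Prop :=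
  ∃ θ : ℝ → ℂ, Continuous θ ∧
    (∀ t : ℝ, Complex.exp (θ t) = g (circleMap z₀ r t) - g z₀) ∧
    θ (2 * Real.pi) = θ 0 + 2 * Real.pi * Complex.I

/-- The restriction of `g` to the open set `G` is an orientation-preserving homeomorphism onto an
open subset of the plane. -/
def IsOrientationPreservingHomeoOn (G : Set ℂ) (g : ℂ → ℂ) : Prop :=
  Topology.IsOpenEmbedding (G.domRestrict g) ∧
    ∀ (z₀ : ℂ) (r : ℝ), 0 < r → Metric.closedBall z₀ r ⊆ G → WindsOnceAround g z₀ r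

/-- `g` is `k`-quasiconformal in the open set `G` (analytic definition). -/
def IsKQuasiconformalOn (k : ℝ) (G : Set ℂ) (g : ℂ → ℂ) : Prop :=
  IsOrientationPreservingHomeoOn G g ∧
    ∃ p q : ℂ → ℂ, HasWeakDz G g p ∧ HasWeakDzbar G g q ∧
      ∀ᵐ z ∂(MeasureTheory.volume.restrict G), ‖q z‖ ≤ k * ‖p z‖

/-- The parametrization `z ↦ z` of the Riemann sphere minus `∞` (inverse of the chart `z`). -/
def sphereParamFinite (z : ℂ) : OnePoint ℂ := (z : OnePoint ℂ)

/-- The parametrization `w ↦ 1 / w`, `0 ↦ ∞`, of the Riemann sphere minus `0`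
(inverse of the chart `1 / z`). -/
noncomputable def sphereParamInfty (w : ℂ) : OnePoint ℂ :=
  open Classical in if w = 0 then OnePoint.infty else ((w⁻¹ : ℂ) : OnePoint ℂ)

/-- The (inverses of the) two standard charts of the Riemann sphere. -/
def IsSphereParam (α : ℂ → OnePoint ℂ) : Prop :=
  α = sphereParamFinite ∨ α = sphereParamInfty

/-- A self-homeomorphism of the Riemann sphere is `k`-quasiconformal if near every point `P` it is
given, in one of the standard charts around `P` and one around `F P`, by a `k`-quasiconformal map
of an open subset of the plane. -/
def IsKQuasiconformalSphere (k : ℝ) (F : OnePoint ℂ ≃ₜ OnePoint ℂ) : Prop :=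
  ∀ P : OnePoint ℂ, ∃ α β : ℂ → OnePoint ℂ, IsSphereParam α ∧ IsSphereParam β ∧
    ∃ (G : Set ℂ) (g : ℂ → ℂ), IsOpen G ∧ P ∈ α '' G ∧ (∀ z ∈ G, F (α z) = β (g z)) ∧
      IsKQuasiconformalOn k G g

/-! In logarithmic coordinates `f` becomes g(ζ) = log f(e^ζ) on the left half-plane. This g commutes
with translation by 2πi, and g'(ζ) = z f'(z)/f(z) lies in B for z = e^ζ. Since B is convex and
closed, all difference quotients of g lie in B, also after g is extended continuously to the
imaginary axis. The ratio condition places B inside an Apollonius disk |b - a| ≤ k|b + a|, where |a|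
is the geometric mean of the extreme moduli in B (`exists_disk_center`).

On the right half-plane put G(ξ + iη) = g(iη) + aξ. The ξ-derivative is a and the quotients in the
direction i are ib with b in B, so the complex dilatation has the form (a - b)/(a + b), of modulus
at most k. Since Re(b/a) > 0, the rays of direction a issuing from the curve g(iℝ) meet neither each
other nor the image of the left half-plane. A connectedness argument shows that rays and image fill
the plane. Thus G is a Lipschitz bijection (`isQCLogLift_rayExtension`).

Finally F(e^ζ) = e^{G(ζ)} descends to a homeomorphism of the plane that extends `f`. Its derivative
is at most M|F(w)|/|w|, which is locally integrable, so the origin is removable for the weak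
derivatives (`hasWeakDz_univ_of_lipschitzNear`). Orientation follows by moving the centre of a
circle to 0 (`windsOnceAround_expConj`). In the chart 1/z the lift is -G(-ζ), so infinity needs no
separate analysis. -/

open Filter Topology MeasureTheory Set Metric
open scoped NNReal ContDiff

/-! ### Pointwise local Lipschitz calculus -/

/-- `f` is Lipschitz on some neighbourhood of `x`. -/
def LipschitzNear {X Y : Type*} [PseudoEMetricSpace X] [PseudoEMetricSpace Y]
    (f : X → Y) (x : X) : Prop :=
  ∃ K : ℝ≥0, ∃ t ∈ 𝓝 x, LipschitzOnWith K f t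

namespace LipschitzNear

variable {X Y Z : Type*} [PseudoEMetricSpace X] [PseudoEMetricSpace Y] [PseudoEMetricSpace Z]

theorem comp {g : Y → Z} {f : X → Y} {x : X} (hg : LipschitzNear g (f x))
    (hf : LipschitzNear f x) : LipschitzNear (g ∘ f) x := by
  obtain ⟨K, t, ht, hK⟩ := hg
  obtain ⟨K', t', ht', hK'⟩ := hf
  have hc : ContinuousAt f x := hK'.continuousOn.continuousAt ht'
  exact ⟨K * K', t' ∩ f ⁻¹' t, inter_mem ht' (hc ht),
    hK.comp (hK'.mono inter_subset_left) fun y hy => hy.2⟩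

theorem prodMk {f : X → Y} {g : X → Z} {x : X} (hf : LipschitzNear f x)
    (hg : LipschitzNear g x) : LipschitzNear (fun y => (f y, g y)) x := by
  obtain ⟨K, t, ht, hK⟩ := hf
  obtain ⟨K', t', ht', hK'⟩ := hg
  exact ⟨max K K', t ∩ t', inter_mem ht ht',
    (hK.mono inter_subset_left).prodMk (hK'.mono inter_subset_right)⟩

theorem congr {f g : X → Y} {x : X} (hf : LipschitzNear f x) (h : f =ᶠ[𝓝 x] g) :
    LipschitzNear g x := by
  obtain ⟨K, t, ht, hK⟩ := hf
  refine ⟨K, t ∩ {y | f y = g y}, inter_mem ht h, ?_⟩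
  intro y hy z hz
  rw [← show f y = g y from hy.2, ← show f z = g z from hz.2]
  exact hK hy.1 hz.1

end LipschitzNear

theorem ContDiffAt.lipschitzNear {E E' : Type*} [NormedAddCommGroup E] [NormedSpace ℝ E]
    [NormedAddCommGroup E'] [NormedSpace ℝ E'] {f : E → E'} {x : E} (hf : ContDiffAt ℝ 1 f x) :
    LipschitzNear f x :=
  hf.exists_lipschitzOnWith

theorem LipschitzNear.mul {X : Type*} [PseudoEMetricSpace X] {f g : X → ℂ} {x : X}
    (hf : LipschitzNear f x) (hg : LipschitzNear g x) : LipschitzNear (fun y => f y * g y) x := by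
  have h : ContDiffAt ℝ 1 (fun p : ℂ × ℂ => p.1 * p.2) (f x, g x) :=
    (contDiff_fst.mul contDiff_snd).contDiffAt
  exact LipschitzNear.comp (f := fun y => (f y, g y)) h.lipschitzNear (hf.prodMk hg)

/-- Compactness gives a constant on a ball slightly larger than the support. A point outside that
ball is at distance at least 1 from the support, so there the supremum of |ψ| serves as a constant.
-/
theorem exists_lipschitzWith_of_hasCompactSupport {ψ : ℂ → ℂ} (hψ : ∀ z, LipschitzNear ψ z)
    (hs : HasCompactSupport ψ) : ∃ C, LipschitzWith C ψ := by
  have hl : LocallyLipschitz ψ := hψ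
  have hc := hl.continuous
  obtain ⟨R, hR⟩ := hs.isBounded.subset_closedBall 0
  obtain ⟨M, hM⟩ := hc.bounded_above_of_compact_support hs
  obtain ⟨K, hK⟩ := (hl.locallyLipschitzOn (s := closedBall 0 (R + 1))).exists_lipschitzOnWith_of_compact
    (isCompact_closedBall _ _)
  have hM0 : 0 ≤ M := (norm_nonneg _).trans (hM 0)
  have key : ∀ x y : ℂ, x ∈ tsupport ψ → dist (ψ x) (ψ y) ≤ max (K : ℝ) M * dist x y := by
    intro x y hx
    have hx' : x ∈ closedBall 0 R := hR hx
    by_cases hy : y ∈ closedBall 0 (R + 1)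
    · refine (hK.dist_le_mul x (closedBall_subset_closedBall (by linarith) hx') y hy).trans ?_
      gcongr; exact le_max_left _ _
    · have hy0 : ψ y = 0 := by
        apply image_eq_zero_of_notMem_tsupport
        exact fun h => hy (closedBall_subset_closedBall (by linarith) (hR h))
      rw [mem_closedBall, not_le] at hy
      rw [mem_closedBall] at hx'
      have h1 : 1 ≤ dist x y := by
        have := dist_triangle_left y 0 x
        linarith [dist_comm y x, dist_comm x 0]
      rw [hy0, dist_zero_right]
      calc ‖ψ x‖ ≤ M := hM x
        _ ≤ max (K : ℝ) M * 1 := by rw [mul_one]; exact le_max_right _ _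
        _ ≤ _ := by gcongr
  refine ⟨⟨max (K : ℝ) M, by positivity⟩, LipschitzWith.of_dist_le_mul fun x y => ?_⟩
  by_cases hx : x ∈ tsupport ψ
  · exact key x y hx
  by_cases hy : y ∈ tsupport ψ
  · rw [dist_comm, dist_comm x]; exact key y x hy
  · rw [image_eq_zero_of_notMem_tsupport hx, image_eq_zero_of_notMem_tsupport hy, dist_self]
    have : (0 : ℝ) ≤ max (K : ℝ) M := by positivity
    exact mul_nonneg this dist_nonneg

/-! ### Integration by parts for Lipschitz functions -/

/-- Integration by parts against the constant 1. By Rademacher's theorem the line derivative agrees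
almost everywhere with the Fréchet derivative. -/
theorem integral_fderiv_real_eq_zero {h : ℂ → ℝ} {C : ℝ≥0} (hh : LipschitzWith C h)
    (hs : HasCompactSupport h) (v : ℂ) : ∫ z, fderiv ℝ h z v = 0 := by
  have h1 := LipschitzWith.integral_lineDeriv_mul_eq (μ := volume)
    (LipschitzWith.const (α := ℂ) (1 : ℝ)) hh hs (-v)
  simp only [neg_neg, mul_one] at h1
  have h2 : ∀ x : ℂ, lineDeriv ℝ (fun _ : ℂ => (1 : ℝ)) x (-v) = 0 := by
    intro x; simp [lineDeriv]
  simp only [h2, zero_mul, integral_zero] at h1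
  rw [h1]
  refine integral_congr_ae ?_
  filter_upwards [hh.ae_differentiableAt] with x hx
  exact hx.lineDeriv_eq_fderiv.symm

theorem integral_fderiv_eq_zero {ψ : ℂ → ℂ} {C : ℝ≥0} (hψ : LipschitzWith C ψ)
    (hs : HasCompactSupport ψ) (v : ℂ) : ∫ z, fderiv ℝ ψ z v = 0 := by
  have hint : Integrable (fun z => fderiv ℝ ψ z v) := by
    have hsupp : HasCompactSupport (fun z => fderiv ℝ ψ z v) := hs.fderiv_apply ℝ v
    refine (IntegrableOn.integrable_of_forall_notMem_eq_zero (s := tsupport ψ) ?_ ?_)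
    · refine Measure.integrableOn_of_bounded (M := C * ‖v‖) hs.measure_lt_top.ne
        (measurable_fderiv_apply_const ℝ ψ v).aestronglyMeasurable ?_
      refine Eventually.of_forall fun z => ?_
      exact (ContinuousLinearMap.le_opNorm _ _).trans (by
        gcongr; exact norm_fderiv_le_of_lipschitz ℝ hψ)
    · intro z hz
      have : fderiv ℝ ψ z = 0 := by
        by_contra hne
        exact hz (support_fderiv_subset ℝ hne)
      simp [this]
  have hcomp : ∀ L : ℂ →L[ℝ] ℝ, L (∫ z, fderiv ℝ ψ z v) = 0 := by
    intro L
    rw [← L.integral_comp_comm hint]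
    rw [← integral_fderiv_real_eq_zero (h := L ∘ ψ) (L.lipschitz.comp hψ)
      (hs.comp_left (map_zero L)) v]
    refine integral_congr_ae ?_
    filter_upwards [hψ.ae_differentiableAt] with x hx
    rw [fderiv_comp x L.differentiableAt hx]
    simp
  apply Complex.ext
  · exact hcomp Complex.reCLM
  · exact hcomp Complex.imCLM

/-! ### Weak derivatives across a singularity of order 1/|z| at the origin -/

/-- In polar coordinates the Jacobian cancels the integrand. -/
theorem locallyIntegrable_norm_inv : LocallyIntegrable (fun z : ℂ => ‖z‖⁻¹) := by
  rw [locallyIntegrable_iff]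
  intro K hK
  obtain ⟨R, hR⟩ := hK.isBounded.subset_ball 0
  refine IntegrableOn.mono_set ?_ hR
  refine ⟨by fun_prop, ?_⟩
  rw [hasFiniteIntegral_iff_enorm, ← lintegral_indicator measurableSet_ball,
    ← Complex.lintegral_comp_polarCoord_symm]
  have hle : ∀ p ∈ polarCoord.target, ENNReal.ofReal p.1 • (ball (0 : ℂ) R).indicator
      (fun z => ‖‖z‖⁻¹‖ₑ) (Complex.polarCoord.symm p) ≤
      (Ioo 0 R ×ˢ Ioo (-Real.pi) Real.pi).indicator 1 p := by
    intro p hp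
    rw [polarCoord_target] at hp
    have hp1 : 0 < p.1 := hp.1
    have hn : ‖Complex.polarCoord.symm p‖ = p.1 := by
      rw [Complex.norm_polarCoord_symm, abs_of_pos hp1]
    by_cases hpR : p.1 < R
    · have hpm : p ∈ Ioo 0 R ×ˢ Ioo (-Real.pi) Real.pi := ⟨⟨hp1, hpR⟩, hp.2⟩
      rw [indicator_of_mem (by rwa [mem_ball_zero_iff, hn]), indicator_of_mem hpm, hn]
      rw [Real.enorm_eq_ofReal (by positivity), smul_eq_mul, ← ENNReal.ofReal_mul hp1.le,
        mul_inv_cancel₀ hp1.ne']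
      simp
    · rw [indicator_of_notMem (by rwa [mem_ball_zero_iff, hn])]
      simp
  calc _ ≤ ∫⁻ p in polarCoord.target, (Ioo 0 R ×ˢ Ioo (-Real.pi) Real.pi).indicator 1 p :=
        setLIntegral_mono' polarCoord.open_target.measurableSet hle
    _ ≤ ∫⁻ p, (Ioo 0 R ×ˢ Ioo (-Real.pi) Real.pi).indicator 1 p := setLIntegral_le_lintegral _ _
    _ = volume (Ioo 0 R ×ˢ Ioo (-Real.pi) Real.pi) :=
        lintegral_indicator_one (measurableSet_Ioo.prod measurableSet_Ioo)
    _ < ⊤ := by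
        rw [Measure.volume_eq_prod, Measure.prod_prod, Real.volume_Ioo, Real.volume_Ioo]
        exact ENNReal.mul_lt_top ENNReal.ofReal_lt_top ENNReal.ofReal_lt_top

/-- A smooth function vanishing near `0` and equal to `1` away from `0`. -/
noncomputable def awayFromZero : ℂ → ℂ :=
  fun z => ((1 - (⟨1, 2, one_pos, one_lt_two⟩ : ContDiffBump (0 : ℂ)) z : ℝ) : ℂ)

theorem contDiff_awayFromZero : ContDiff ℝ ∞ awayFromZero := by
  unfold awayFromZero
  exact Complex.ofRealCLM.contDiff.comp (contDiff_const.sub (ContDiffBump.contDiff _))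

theorem awayFromZero_eq_zero {z : ℂ} (hz : ‖z‖ ≤ 1) : awayFromZero z = 0 := by
  unfold awayFromZero
  rw [ContDiffBump.one_of_mem_closedBall]
  · simp
  · simpa using hz

theorem awayFromZero_eq_one {z : ℂ} (hz : 2 ≤ ‖z‖) : awayFromZero z = 1 := by
  unfold awayFromZero
  rw [ContDiffBump.zero_of_le_dist]
  · simp
  · simpa using hz

theorem norm_awayFromZero_le (z : ℂ) : ‖awayFromZero z‖ ≤ 1 := by
  unfold awayFromZero
  rw [Complex.norm_real, Real.norm_eq_abs, abs_le]
  have h0 := (⟨1, 2, one_pos, one_lt_two⟩ : ContDiffBump (0 : ℂ)).nonneg (x := z)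
  have h1 := (⟨1, 2, one_pos, one_lt_two⟩ : ContDiffBump (0 : ℂ)).le_one (x := z)
  constructor <;> linarith

theorem fderiv_awayFromZero_eq_zero {z : ℂ} (hz : 2 < ‖z‖) : fderiv ℝ awayFromZero z = 0 := by
  have h : awayFromZero =ᶠ[𝓝 z] fun _ => 1 := by
    filter_upwards [(isOpen_lt continuous_const continuous_norm).mem_nhds hz] with w hw
    exact awayFromZero_eq_one (le_of_lt hw)
  rw [h.fderiv_eq]; simp

/-- The quantity is invariant under scaling, so the cutoffs z ↦ `awayFromZero (n * z)` all have
gradient at most C/|z|. This supplies a dominating function independent of n. -/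
theorem exists_norm_mul_fderiv_awayFromZero_le :
    ∃ C : ℝ, 0 ≤ C ∧ ∀ z, ‖z‖ * ‖fderiv ℝ awayFromZero z‖ ≤ C := by
  have hc : Continuous fun z => ‖z‖ * ‖fderiv ℝ awayFromZero z‖ :=
    continuous_norm.mul (contDiff_awayFromZero.continuous_fderiv (by simp)).norm
  obtain ⟨C, hC⟩ := (isCompact_closedBall (0 : ℂ) 2).exists_bound_of_continuousOn hc.continuousOn
  refine ⟨max C 0, le_max_right _ _, fun z => ?_⟩
  by_cases hz : ‖z‖ ≤ 2
  · exact (le_abs_self _).trans ((hC z (by simpa using hz)).trans (le_max_left _ _))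
  · rw [fderiv_awayFromZero_eq_zero (not_le.1 hz)]; simp

theorem HasCompactSupport.integrable_mul_norm_inv {g : ℂ → ℝ} (hg : Continuous g)
    (hs : HasCompactSupport g) : Integrable fun z => g z * ‖z‖⁻¹ :=
  locallyIntegrable_norm_inv.integrable_smul_left_of_hasCompactSupport hg hs

theorem awayFromZero_scaled_tendsto {z : ℂ} (hz : z ≠ 0) :
    ∀ᶠ n : ℕ in atTop, awayFromZero ((n : ℂ) * z) = 1 ∧
      fderiv ℝ awayFromZero ((n : ℂ) * z) = 0 := by
  have hz' : 0 < ‖z‖ := norm_pos_iff.2 hz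
  have : ∀ᶠ n : ℕ in atTop, 2 / ‖z‖ < n := tendsto_natCast_atTop_atTop.eventually_gt_atTop _
  filter_upwards [this] with n hn
  have : 2 < ‖(n : ℂ) * z‖ := by
    rw [norm_mul, Complex.norm_natCast]
    exact (div_lt_iff₀ hz').1 hn
  exact ⟨awayFromZero_eq_one this.le, fderiv_awayFromZero_eq_zero this⟩

theorem hasFDerivAt_awayFromZero_scaled (n : ℕ) (z : ℂ) :
    HasFDerivAt (fun w : ℂ => awayFromZero ((n : ℂ) * w))
      ((n : ℝ) • fderiv ℝ awayFromZero ((n : ℂ) * z)) z := by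
  have h1 : HasFDerivAt (fun w : ℂ => (n : ℂ) * w) ((n : ℝ) • ContinuousLinearMap.id ℝ ℂ) z := by
    have := ((n : ℝ) • ContinuousLinearMap.id ℝ ℂ).hasFDerivAt (x := z)
    convert! this using 1
  have h2 := (contDiff_awayFromZero.differentiable (by simp) ((n : ℂ) * z)).hasFDerivAt
  convert! h2.comp z h1 using 1
  ext w; simp

/-- Near 0 the function `F` is merely continuous, so the test function is multiplied by a cutoff `η
n` vanishing near 0. The product with `F` is then globally Lipschitz with compact support, and its
derivative integrates to zero. Every term is dominated by a continuous compactly supported function,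
possibly times 1/|z|, so the cutoff can be removed in the limit. -/
theorem integral_mul_fderiv_eq_neg_of_lipschitzNear {F : ℂ → ℂ} {B : ℂ → ℝ} (hF : Continuous F)
    (hlip : ∀ z, z ≠ 0 → LipschitzNear F z) (hdiff : ∀ᵐ z, DifferentiableAt ℝ F z)
    (hB : Continuous B) (hbound : ∀ᵐ z, ‖fderiv ℝ F z‖ ≤ B z * ‖z‖⁻¹)
    {φ : ℂ → ℂ} (hφ : ContDiff ℝ ∞ φ) (hs : HasCompactSupport φ) (v : ℂ) :
    ∫ z, F z * fderiv ℝ φ z v = - ∫ z, fderiv ℝ F z v * φ z := by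
  obtain ⟨C, hC0, hC⟩ := exists_norm_mul_fderiv_awayFromZero_le
  have hφc := hφ.continuous
  have hdφ : Continuous (fderiv ℝ φ) := hφ.continuous_fderiv (by simp)
  have hφd : Differentiable ℝ φ := hφ.differentiable (by simp)
  set η : ℕ → ℂ → ℂ := fun n z => awayFromZero ((n : ℂ) * z) with hη
  have hηs : ∀ n, ContDiff ℝ ∞ (η n) := fun n =>
    contDiff_awayFromZero.comp (contDiff_const.mul contDiff_id)
  set ψ : ℕ → ℂ → ℂ := fun n z => F z * (φ z * η n z) with hψ
  set D : ℕ → ℂ → ℂ := fun n z => F z * (φ z * ((n : ℝ) • fderiv ℝ awayFromZero ((n : ℂ) * z) v)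
    + η n z * fderiv ℝ φ z v) + (φ z * η n z) * fderiv ℝ F z v with hD
  have hzero : ∀ n : ℕ, 0 < n → ∫ z, D n z = 0 := by
    intro n hn
    have hn' : (0 : ℝ) < n := by exact_mod_cast hn
    have hlipψ : ∀ z, LipschitzNear (ψ n) z := by
      intro z
      by_cases hz : z = 0
      · have : (fun _ : ℂ => (0 : ℂ)) =ᶠ[𝓝 z] ψ n := by
          have hb : ball (0 : ℂ) (1 / n) ∈ 𝓝 z := by
            rw [hz]; exact ball_mem_nhds _ (by positivity)
          filter_upwards [hb] with w hw
          have : awayFromZero ((n : ℂ) * w) = 0 := by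
            apply awayFromZero_eq_zero
            rw [norm_mul, Complex.norm_natCast]
            rw [mem_ball_zero_iff, lt_div_iff₀ hn'] at hw
            linarith
          simp [hψ, hη, this]
        exact LipschitzNear.congr (contDiff_const.contDiffAt.lipschitzNear) this
      · refine (hlip z hz).mul ?_
        exact ((hφ.mul (hηs n)).of_le (by simp)).contDiffAt.lipschitzNear
    have hsψ : HasCompactSupport (ψ n) := (hs.mul_right).mul_left
    obtain ⟨K, hK⟩ := exists_lipschitzWith_of_hasCompactSupport hlipψ hsψ
    rw [← integral_fderiv_eq_zero hK hsψ v]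
    refine integral_congr_ae ?_
    filter_upwards [hdiff] with z hz
    have h1 := hz.hasFDerivAt.mul
      ((hφd z).hasFDerivAt.mul (hasFDerivAt_awayFromZero_scaled n z))
    have h2 : fderiv ℝ (ψ n) z = _ := h1.fderiv
    rw [h2]
    simp [hD, hη]
    ring
  have hb1 : Integrable fun z => (‖F z‖ * ‖φ z‖ * (C * ‖v‖)) * ‖z‖⁻¹ :=
    HasCompactSupport.integrable_mul_norm_inv (by fun_prop) ((hs.norm.mul_left).mul_right)
  have hb2 : Integrable fun z => ‖F z‖ * (‖fderiv ℝ φ z‖ * ‖v‖) :=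
    Continuous.integrable_of_hasCompactSupport (by fun_prop)
      (((hs.fderiv ℝ).norm.mul_right).mul_left)
  have hb3 : Integrable fun z => (‖φ z‖ * (B z * ‖v‖)) * ‖z‖⁻¹ :=
    HasCompactSupport.integrable_mul_norm_inv (by fun_prop) (hs.norm.mul_right)
  have hmF : Measurable fun z => fderiv ℝ F z v := measurable_fderiv_apply_const ℝ F v
  have hlim : Tendsto (fun n => ∫ z, D n z) atTop
      (𝓝 (∫ z, F z * fderiv ℝ φ z v + φ z * fderiv ℝ F z v)) := by
    refine tendsto_integral_of_dominated_convergence (fun z =>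
      (‖F z‖ * ‖φ z‖ * (C * ‖v‖)) * ‖z‖⁻¹ + ‖F z‖ * (‖fderiv ℝ φ z‖ * ‖v‖) +
        (‖φ z‖ * (B z * ‖v‖)) * ‖z‖⁻¹) ?_ ((hb1.add hb2).add hb3) ?_ ?_
    · intro n
      have hdη : Continuous fun z : ℂ => fderiv ℝ awayFromZero ((n : ℂ) * z) v :=
        ((contDiff_awayFromZero.continuous_fderiv (by simp)).comp (by fun_prop)).clm_apply
          continuous_const
      have hηc := (hηs n).continuous
      refine AEStronglyMeasurable.add (Continuous.aestronglyMeasurable ?_) ?_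
      · fun_prop
      · exact (hφc.mul hηc).aestronglyMeasurable.mul hmF.aestronglyMeasurable
    · intro n
      have hne : ∀ᵐ z : ℂ, z ≠ 0 := by simp [ae_iff]
      filter_upwards [hbound, hne] with z hz hz0
      have hz' : 0 < ‖z‖ := norm_pos_iff.2 hz0
      have e1 : ‖(n : ℝ) • fderiv ℝ awayFromZero ((n : ℂ) * z) v‖ ≤ (C * ‖v‖) * ‖z‖⁻¹ := by
        rw [← div_eq_mul_inv, le_div_iff₀ hz', norm_smul]
        have := hC ((n : ℂ) * z)
        rw [norm_mul, Complex.norm_natCast] at this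
        calc ‖(n : ℝ)‖ * ‖fderiv ℝ awayFromZero ((n : ℂ) * z) v‖ * ‖z‖
            ≤ n * (‖fderiv ℝ awayFromZero ((n : ℂ) * z)‖ * ‖v‖) * ‖z‖ := by
              rw [Real.norm_natCast]; gcongr; exact ContinuousLinearMap.le_opNorm _ _
          _ = (n * ‖z‖ * ‖fderiv ℝ awayFromZero ((n : ℂ) * z)‖) * ‖v‖ := by ring
          _ ≤ C * ‖v‖ := by gcongr
      have e2 : ‖η n z‖ ≤ 1 := norm_awayFromZero_le _
      have e3 : ‖fderiv ℝ F z v‖ ≤ B z * ‖z‖⁻¹ * ‖v‖ :=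
        (ContinuousLinearMap.le_opNorm _ _).trans (by gcongr)
      calc ‖D n z‖ ≤ ‖F z‖ * (‖φ z‖ * ‖(n : ℝ) • fderiv ℝ awayFromZero ((n : ℂ) * z) v‖
              + ‖η n z‖ * ‖fderiv ℝ φ z v‖) + (‖φ z‖ * ‖η n z‖) * ‖fderiv ℝ F z v‖ := by
            refine (norm_add_le _ _).trans ?_
            rw [norm_mul, norm_mul, norm_mul]
            gcongr
            refine (norm_add_le _ _).trans ?_
            rw [norm_mul, norm_mul]
        _ ≤ ‖F z‖ * (‖φ z‖ * ((C * ‖v‖) * ‖z‖⁻¹)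
              + 1 * (‖fderiv ℝ φ z‖ * ‖v‖)) + (‖φ z‖ * 1) * (B z * ‖z‖⁻¹ * ‖v‖) := by
            gcongr
            exact ContinuousLinearMap.le_opNorm _ _
        _ = _ := by ring
    · have hne : ∀ᵐ z : ℂ, z ≠ 0 := by simp [ae_iff]
      filter_upwards [hne] with z hz
      refine tendsto_const_nhds.congr' ?_
      filter_upwards [awayFromZero_scaled_tendsto hz] with n hn
      simp [hD, hη, hn.1, hn.2]
  have hconst : Tendsto (fun n => ∫ z, D n z) atTop (𝓝 0) := by
    refine tendsto_const_nhds.congr' ?_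
    filter_upwards [eventually_gt_atTop 0] with n hn
    exact (hzero n hn).symm
  have hfin := tendsto_nhds_unique hlim hconst
  have hi1 : Integrable fun z => F z * fderiv ℝ φ z v := by
    refine Continuous.integrable_of_hasCompactSupport
      (hF.mul (hdφ.clm_apply continuous_const)) ?_
    exact (hs.fderiv_apply ℝ v).mul_left
  have hi2 : Integrable fun z => φ z * fderiv ℝ F z v := by
    refine hb3.mono' (hφc.aestronglyMeasurable.mul hmF.aestronglyMeasurable) ?_
    filter_upwards [hbound] with z hz
    rw [norm_mul]
    calc ‖φ z‖ * ‖fderiv ℝ F z v‖ ≤ ‖φ z‖ * (B z * ‖z‖⁻¹ * ‖v‖) := by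
          gcongr; exact (ContinuousLinearMap.le_opNorm _ _).trans (by gcongr)
      _ = _ := by ring
  rw [integral_add hi1 hi2] at hfin
  rw [eq_neg_of_add_eq_zero_left hfin]
  simp_rw [mul_comm (φ _)]

theorem locallyIntegrable_fderiv_apply {F : ℂ → ℂ} {B : ℂ → ℝ} (hB : Continuous B)
    (hbound : ∀ᵐ z, ‖fderiv ℝ F z‖ ≤ B z * ‖z‖⁻¹) (v : ℂ) :
    LocallyIntegrable fun z => fderiv ℝ F z v := by
  have h : LocallyIntegrable fun z => (B z * ‖v‖) * ‖z‖⁻¹ := by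
    rw [locallyIntegrable_iff]
    intro K hK
    exact ((locallyIntegrable_iff.1 locallyIntegrable_norm_inv K hK).continuousOn_mul
      (hB.mul continuous_const).continuousOn hK)
  refine h.mono (measurable_fderiv_apply_const ℝ F v).aestronglyMeasurable ?_
  filter_upwards [hbound] with z hz
  calc ‖fderiv ℝ F z v‖ ≤ (B z * ‖z‖⁻¹) * ‖v‖ :=
        (ContinuousLinearMap.le_opNorm _ _).trans (by gcongr)
    _ = (B z * ‖v‖) * ‖z‖⁻¹ := by ring
    _ ≤ _ := le_abs_self _

theorem hasWeakDz_univ_of_lipschitzNear {F : ℂ → ℂ} {B : ℂ → ℝ} (hF : Continuous F)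
    (hlip : ∀ z, z ≠ 0 → LipschitzNear F z) (hdiff : ∀ᵐ z, DifferentiableAt ℝ F z)
    (hB : Continuous B) (hbound : ∀ᵐ z, ‖fderiv ℝ F z‖ ≤ B z * ‖z‖⁻¹) :
    HasWeakDz univ F (wirtingerDz F) ∧ HasWeakDzbar univ F (wirtingerDzbar F) := by
  have hl := fun v => locallyIntegrable_fderiv_apply hB hbound v
  have hint : ∀ φ : ℂ → ℂ, IsPlaneTestFunction univ φ → ∀ v,
      Integrable (fun z => F z * fderiv ℝ φ z v) ∧
      Integrable (fun z => fderiv ℝ F z v * φ z) := by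
    rintro φ ⟨hφ, hs, -⟩ v
    refine ⟨Continuous.integrable_of_hasCompactSupport
      (hF.mul ((hφ.continuous_fderiv (by simp)).clm_apply continuous_const))
      (hs.fderiv_apply ℝ v).mul_left, ?_⟩
    exact (hl v).integrable_smul_right_of_hasCompactSupport hφ.continuous hs
  constructor
  · refine ⟨locallyIntegrableOn_univ.2 ?_, fun φ hφ => ?_⟩
    · have := ((hl 1).sub ((hl Complex.I).smul Complex.I)).smul (1 / 2 : ℂ)
      have heq : wirtingerDz F = (1 / 2 : ℂ) • ((fun z => fderiv ℝ F z 1) -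
          Complex.I • fun z => fderiv ℝ F z Complex.I) := by
        funext z; simp [wirtingerDz]; ring
      rwa [heq]
    · have ibp := integral_mul_fderiv_eq_neg_of_lipschitzNear hF hlip hdiff hB hbound hφ.1 hφ.2.1
      have e1 : ∀ z, F z * wirtingerDz φ z = (1 / 2) * (F z * fderiv ℝ φ z 1) -
          (Complex.I / 2) * (F z * fderiv ℝ φ z Complex.I) := fun z => by
        rw [wirtingerDz]; ring
      have e2 : ∀ z, wirtingerDz F z * φ z = (1 / 2) * (fderiv ℝ F z 1 * φ z) -
          (Complex.I / 2) * (fderiv ℝ F z Complex.I * φ z) := fun z => by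
        rw [wirtingerDz]; ring
      simp_rw [e1, e2]
      rw [integral_sub ((hint φ hφ 1).1.const_mul _) ((hint φ hφ _).1.const_mul _),
        integral_sub ((hint φ hφ 1).2.const_mul _) ((hint φ hφ _).2.const_mul _)]
      simp_rw [integral_const_mul, ibp]
      ring
  · refine ⟨locallyIntegrableOn_univ.2 ?_, fun φ hφ => ?_⟩
    · have := ((hl 1).add ((hl Complex.I).smul Complex.I)).smul (1 / 2 : ℂ)
      have heq : wirtingerDzbar F = (1 / 2 : ℂ) • ((fun z => fderiv ℝ F z 1) +
          Complex.I • fun z => fderiv ℝ F z Complex.I) := by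
        funext z; simp [wirtingerDzbar]; ring
      rwa [heq]
    · have ibp := integral_mul_fderiv_eq_neg_of_lipschitzNear hF hlip hdiff hB hbound hφ.1 hφ.2.1
      have e1 : ∀ z, F z * wirtingerDzbar φ z = (1 / 2) * (F z * fderiv ℝ φ z 1) +
          (Complex.I / 2) * (F z * fderiv ℝ φ z Complex.I) := fun z => by
        rw [wirtingerDzbar]; ring
      have e2 : ∀ z, wirtingerDzbar F z * φ z = (1 / 2) * (fderiv ℝ F z 1 * φ z) +
          (Complex.I / 2) * (fderiv ℝ F z Complex.I * φ z) := fun z => by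
        rw [wirtingerDzbar]; ring
      simp_rw [e1, e2]
      rw [integral_add ((hint φ hφ 1).1.const_mul _) ((hint φ hφ _).1.const_mul _),
        integral_add ((hint φ hφ 1).2.const_mul _) ((hint φ hφ _).2.const_mul _)]
      simp_rw [integral_const_mul, ibp]
      ring

/-! ### Descending a logarithmic lift to a quasiconformal map of the sphere -/

/-- Maps of the plane commuting with translation by `2πi` which are Lipschitz, bijective, proper in
the real direction and satisfy the Beltrami inequality with constant `k` almost everywhere: the
logarithmic lifts of quasiconformal maps of the sphere fixing `0` and `∞`. -/
structure IsQCLogLift (k : ℝ) (G : ℂ → ℂ) : Prop where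
  lipschitz : ∃ M, LipschitzWith M G
  bijective : Function.Bijective G
  add_period : ∀ ζ, G (ζ + 2 * Real.pi * Complex.I) = G ζ + 2 * Real.pi * Complex.I
  tendsto_atBot : Tendsto (fun ζ => (G ζ).re) (comap Complex.re atBot) atBot
  tendsto_atTop : Tendsto (fun ζ => (G ζ).re) (comap Complex.re atTop) atTop
  ae_le : ∀ᵐ ζ, DifferentiableAt ℝ G ζ ∧ ‖wirtingerDzbar G ζ‖ ≤ k * ‖wirtingerDz G ζ‖

/-- The map of the plane, fixing `0`, whose logarithmic lift is `G`. -/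
noncomputable def expConj (G : ℂ → ℂ) (w : ℂ) : ℂ :=
  open Classical in if w = 0 then 0 else Complex.exp (G (Complex.log w))

@[simp] theorem expConj_zero (G : ℂ → ℂ) : expConj G 0 = 0 := by simp [expConj]

theorem expConj_of_ne_zero (G : ℂ → ℂ) {w : ℂ} (hw : w ≠ 0) :
    expConj G w = Complex.exp (G (Complex.log w)) := by simp [expConj, hw]

theorem expConj_eq_zero_iff {G : ℂ → ℂ} {w : ℂ} : expConj G w = 0 ↔ w = 0 := by
  refine ⟨fun h => ?_, fun h => by simp [h]⟩
  by_contra hw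
  rw [expConj_of_ne_zero G hw] at h
  exact Complex.exp_ne_zero _ h

/-- Precomposition with a complex-linear map multiplies the two Wirtinger derivatives by c and by
its conjugate. The moduli agree, so the Beltrami inequality is preserved. -/
theorem wirtingerDz_comp_mul {F G : ℂ → ℂ} {w ζ e c : ℂ}
    (h : ∀ v, fderiv ℝ F w v = e * fderiv ℝ G ζ (c * v)) :
    wirtingerDz F w = e * c * wirtingerDz G ζ ∧
      wirtingerDzbar F w = e * (starRingEnd ℂ) c * wirtingerDzbar G ζ := by
  have key : ∀ z : ℂ, fderiv ℝ G ζ z = z.re * fderiv ℝ G ζ 1 + z.im * fderiv ℝ G ζ Complex.I := by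
    intro z
    have hz : z = z.re • (1 : ℂ) + z.im • Complex.I := by
      apply Complex.ext <;> simp
    conv_lhs => rw [hz]
    rw [map_add, map_smul, map_smul]; simp
  have hc : c = c.re + c.im * Complex.I := (Complex.re_add_im c).symm
  have hcc : (starRingEnd ℂ) c = c.re - c.im * Complex.I := by
    apply Complex.ext <;> simp
  have hI := Complex.I_sq
  have h1 := key (c * 1)
  have h2 := key (c * Complex.I)
  have r1 : (c * Complex.I).re = -c.im := by simp
  have r2 : (c * Complex.I).im = c.re := by simp
  rw [r1, r2] at h2
  rw [mul_one] at h1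
  constructor
  · rw [wirtingerDz, wirtingerDz, h, h, h2, mul_one, h1]
    conv_rhs => rw [hc]
    push_cast
    linear_combination (-e * c.im * fderiv ℝ G ζ Complex.I / 2 * (-1)) * hI
  · rw [wirtingerDzbar, wirtingerDzbar, h, h, h2, mul_one, h1, hcc]
    push_cast
    linear_combination (e * c.im * fderiv ℝ G ζ Complex.I / 2) * hI

namespace IsQCLogLift

variable {k : ℝ} {G : ℂ → ℂ}

theorem continuous (hG : IsQCLogLift k G) : Continuous G := hG.lipschitz.choose_spec.continuous

theorem add_int_mul (hG : IsQCLogLift k G) (n : ℤ) (ζ : ℂ) :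
    G (ζ + n * (2 * Real.pi * Complex.I)) = G ζ + n * (2 * Real.pi * Complex.I) := by
  induction n using Int.induction_on with
  | zero => simp
  | succ n ih =>
    have := hG.add_period (ζ + (n : ℤ) * (2 * Real.pi * Complex.I))
    rw [ih] at this
    have e : ζ + ((n : ℤ) : ℂ) * (2 * Real.pi * Complex.I) + 2 * Real.pi * Complex.I =
      ζ + ((n + 1 : ℤ) : ℂ) * (2 * Real.pi * Complex.I) := by push_cast; ring
    rw [e] at this
    rw [this]; push_cast; ring
  | pred n ih =>
    have := hG.add_period (ζ + ((-n - 1 : ℤ) : ℂ) * (2 * Real.pi * Complex.I))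
    have e : ζ + ((-n - 1 : ℤ) : ℂ) * (2 * Real.pi * Complex.I) + 2 * Real.pi * Complex.I =
      ζ + ((-n : ℤ) : ℂ) * (2 * Real.pi * Complex.I) := by push_cast; ring
    rw [e, ih] at this
    have e2 := eq_sub_of_add_eq this.symm
    rw [e2]; push_cast; ring

theorem expConj_exp (hG : IsQCLogLift k G) (ζ : ℂ) :
    expConj G (Complex.exp ζ) = Complex.exp (G ζ) := by
  rw [expConj_of_ne_zero G (Complex.exp_ne_zero ζ)]
  obtain ⟨n, hn⟩ := Complex.exp_eq_exp_iff_exists_int.1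
    (Complex.exp_log (Complex.exp_ne_zero ζ))
  rw [hn, hG.add_int_mul, Complex.exp_eq_exp_iff_exists_int]
  exact ⟨n, rfl⟩

/-- Taking ζ to be a logarithm of w turns this into a formula with a branch of the logarithm smooth
near w, so the cut of the principal branch does no harm. -/
theorem expConj_eq (hG : IsQCLogLift k G) (ζ : ℂ) {v : ℂ} (hv : v ≠ 0) :
    expConj G v = Complex.exp (G (ζ + Complex.log (Complex.exp (-ζ) * v))) := by
  rw [← hG.expConj_exp, Complex.exp_add, Complex.exp_log
    (mul_ne_zero (Complex.exp_ne_zero _) hv), ← mul_assoc, ← Complex.exp_add]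
  simp

theorem lipschitzNear_expConj (hG : IsQCLogLift k G) {w : ℂ} (hw : w ≠ 0) :
    LipschitzNear (expConj G) w := by
  obtain ⟨M, hM⟩ := hG.lipschitz
  set ζ := Complex.log w with hζ
  have hw' : Complex.exp (-ζ) * w = 1 := by
    rw [Complex.exp_neg, hζ, Complex.exp_log hw, inv_mul_cancel₀ hw]
  have hlog : ContDiffAt ℝ 1 (fun v => ζ + Complex.log (Complex.exp (-ζ) * v)) w := by
    have : ContDiffAt ℂ 1 Complex.log (Complex.exp (-ζ) * w) :=
      Complex.contDiffAt_log (by rw [hw']; simp)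
    have h2 : ContDiffAt ℂ 1 (fun v : ℂ => Complex.exp (-ζ) * v) w := by fun_prop
    exact (contDiffAt_const.add (ContDiffAt.comp w this h2)).restrict_scalars ℝ
  have hexp : ∀ z, LipschitzNear Complex.exp z := fun z =>
    (Complex.contDiff_exp (𝕜 := ℝ)).contDiffAt.lipschitzNear
  have hGn : ∀ z, LipschitzNear G z := fun z => hM.locallyLipschitz z
  refine LipschitzNear.congr ((hexp _).comp ((hGn _).comp hlog.lipschitzNear)) ?_
  filter_upwards [isOpen_ne.mem_nhds hw] with v hv
  exact (hG.expConj_eq ζ hv).symm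

theorem norm_expConj {G : ℂ → ℂ} {w : ℂ} (hw : w ≠ 0) :
    ‖expConj G w‖ = Real.exp (G (Complex.log w)).re := by
  rw [expConj_of_ne_zero G hw, Complex.norm_exp]

theorem continuous_expConj (hG : IsQCLogLift k G) : Continuous (expConj G) := by
  rw [continuous_iff_continuousAt]
  intro w
  by_cases hw : w = 0
  · rw [hw, ← continuousWithinAt_compl_self, ContinuousWithinAt, expConj_zero,
      tendsto_zero_iff_norm_tendsto_zero]
    have h1 : Tendsto Complex.log (𝓝[≠] 0) (comap Complex.re atBot) := by
      rw [tendsto_comap_iff]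
      have : Complex.re ∘ Complex.log = fun z => Real.log ‖z‖ := by
        funext z; exact Complex.log_re z
      rw [this]
      exact Real.tendsto_log_nhdsGT_zero.comp tendsto_norm_nhdsNE_zero
    refine (Real.tendsto_exp_atBot.comp (hG.tendsto_atBot.comp h1)).congr' ?_
    filter_upwards [self_mem_nhdsWithin] with z hz
    exact (norm_expConj hz).symm
  · obtain ⟨K, t, ht, hK⟩ := hG.lipschitzNear_expConj hw
    exact hK.continuousOn.continuousAt ht

theorem bijective_expConj (hG : IsQCLogLift k G) : Function.Bijective (expConj G) := by
  constructor
  · intro w w' h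
    by_cases hw : w = 0
    · rw [hw, expConj_zero, eq_comm, expConj_eq_zero_iff] at h
      rw [hw, h]
    by_cases hw' : w' = 0
    · rw [hw', expConj_zero, expConj_eq_zero_iff] at h
      exact absurd h hw
    rw [expConj_of_ne_zero G hw, expConj_of_ne_zero G hw'] at h
    obtain ⟨n, hn⟩ := Complex.exp_eq_exp_iff_exists_int.1 h
    rw [← hG.add_int_mul] at hn
    have := congrArg Complex.exp (hG.bijective.1 hn)
    rw [Complex.exp_log hw, Complex.exp_eq_exp_iff_exists_int.2 ⟨n, rfl⟩, Complex.exp_log hw'] at this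
    exact this
  · intro u
    by_cases hu : u = 0
    · exact ⟨0, by rw [hu, expConj_zero]⟩
    · obtain ⟨ζ, hζ⟩ := hG.bijective.2 (Complex.log u)
      exact ⟨Complex.exp ζ, by rw [hG.expConj_exp, hζ, Complex.exp_log hu]⟩

theorem tendsto_cocompact_expConj (hG : IsQCLogLift k G) :
    Tendsto (expConj G) (cocompact ℂ) (cocompact ℂ) := by
  rw [← cobounded_eq_cocompact, ← tendsto_norm_atTop_iff_cobounded]
  have h1 : Tendsto Complex.log (Bornology.cobounded ℂ) (comap Complex.re atTop) := by
    rw [tendsto_comap_iff]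
    have : Complex.re ∘ Complex.log = fun z => Real.log ‖z‖ := by
      funext z; exact Complex.log_re z
    rw [this]
    exact Real.tendsto_log_atTop.comp tendsto_norm_cobounded_atTop
  refine (Real.tendsto_exp_atTop.comp (hG.tendsto_atTop.comp h1)).congr' ?_
  have hne : ∀ᶠ z : ℂ in Bornology.cobounded ℂ, z ≠ 0 := by
    filter_upwards [tendsto_norm_cobounded_atTop.eventually_gt_atTop 0] with z hz
    exact norm_pos_iff.1 hz
  filter_upwards [hne] with z hz
  exact (norm_expConj hz).symm

/-- The homeomorphism of the plane with logarithmic lift `G`. -/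
noncomputable def homeomorph (hG : IsQCLogLift k G) : ℂ ≃ₜ ℂ :=
  (Equiv.ofBijective _ hG.bijective_expConj).toHomeomorphOfContinuousClosed hG.continuous_expConj
    (isProperMap_iff_tendsto_cocompact.2
      ⟨hG.continuous_expConj, hG.tendsto_cocompact_expConj⟩).isClosedMap

@[simp] theorem homeomorph_apply (hG : IsQCLogLift k G) (w : ℂ) :
    hG.homeomorph w = expConj G w := rfl

theorem hasFDerivAt_expConj (hG : IsQCLogLift k G) {ζ : ℂ} (hd : DifferentiableAt ℝ G ζ) :
    DifferentiableAt ℝ (expConj G) (Complex.exp ζ) ∧ ∀ v, fderiv ℝ (expConj G) (Complex.exp ζ) v =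
      Complex.exp (G ζ) * fderiv ℝ G ζ (Complex.exp (-ζ) * v) := by
  have h0 : Complex.exp (-ζ) * Complex.exp ζ = 1 := by rw [← Complex.exp_add]; simp
  have h1 : HasDerivAt (fun v => ζ + Complex.log (Complex.exp (-ζ) * v)) (Complex.exp (-ζ))
      (Complex.exp ζ) := by
    have hm : HasDerivAt (fun v => Complex.exp (-ζ) * v) (Complex.exp (-ζ)) (Complex.exp ζ) := by
      simpa using (hasDerivAt_id (Complex.exp ζ)).const_mul (Complex.exp (-ζ))
    have hl : HasDerivAt Complex.log 1 (Complex.exp (-ζ) * Complex.exp ζ) := by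
      rw [h0]; simpa using Complex.hasDerivAt_log (z := 1) (by simp)
    simpa using (hl.comp _ hm).const_add ζ
  have h1' := h1.hasFDerivAt.restrictScalars ℝ
  have hval : ζ + Complex.log (Complex.exp (-ζ) * Complex.exp ζ) = ζ := by rw [h0]; simp
  have h2 : HasFDerivAt G (fderiv ℝ G ζ) (ζ + Complex.log (Complex.exp (-ζ) * Complex.exp ζ)) := by
    rw [hval]; exact hd.hasFDerivAt
  have h3 := (Complex.hasDerivAt_exp (G ζ)).hasFDerivAt.restrictScalars ℝ
  have h3' : HasFDerivAt Complex.exp ((ContinuousLinearMap.toSpanSingleton ℂ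
      (Complex.exp (G ζ))).restrictScalars ℝ) ((G ∘ fun v => ζ + Complex.log (Complex.exp (-ζ) * v))
      (Complex.exp ζ)) := by
    rw [Function.comp_apply, hval]; exact h3
  have h4 := h3'.comp _ (HasFDerivAt.comp (f := fun v => ζ + Complex.log (Complex.exp (-ζ) * v))
    (Complex.exp ζ) h2 h1')
  have h5 := h4.congr_of_eventuallyEq (f₁ := expConj G) (by
    filter_upwards [isOpen_ne.mem_nhds (Complex.exp_ne_zero ζ)] with v hv
    exact hG.expConj_eq ζ hv)
  refine ⟨h5.differentiableAt, fun v => ?_⟩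
  rw [h5.fderiv]
  simp [mul_comm]

/-- The exponential is differentiable, so it maps the exceptional null set of `G` to a null set.
Every other nonzero w is the exponential of a good ζ, where the chain rule applies. -/
theorem ae_expConj (hG : IsQCLogLift k G) {M : ℝ≥0} (hM : LipschitzWith M G) :
    ∀ᵐ w, DifferentiableAt ℝ (expConj G) w ∧
      ‖fderiv ℝ (expConj G) w‖ ≤ (M * ‖expConj G w‖) * ‖w‖⁻¹ ∧
      ‖wirtingerDzbar (expConj G) w‖ ≤ k * ‖wirtingerDz (expConj G) w‖ := by
  have hnull : volume (Complex.exp '' {ζ | ¬ (DifferentiableAt ℝ G ζ ∧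
      ‖wirtingerDzbar G ζ‖ ≤ k * ‖wirtingerDz G ζ‖)}) = 0 :=
    addHaar_image_eq_zero_of_differentiableOn_of_addHaar_eq_zero _
      ((Complex.differentiable_exp (𝕜 := ℝ)).differentiableOn) hG.ae_le
  have hne : ∀ᵐ w : ℂ, w ≠ 0 := by simp [ae_iff]
  filter_upwards [measure_eq_zero_iff_ae_notMem.1 hnull, hne] with w hw hw0
  obtain ⟨ζ, rfl⟩ : ∃ ζ, Complex.exp ζ = w := ⟨Complex.log w, Complex.exp_log hw0⟩
  have hgood : DifferentiableAt ℝ G ζ ∧ ‖wirtingerDzbar G ζ‖ ≤ k * ‖wirtingerDz G ζ‖ := by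
    by_contra h
    exact hw ⟨ζ, h, rfl⟩
  obtain ⟨hd, hf⟩ := hG.hasFDerivAt_expConj hgood.1
  refine ⟨hd, ?_, ?_⟩
  · refine ContinuousLinearMap.opNorm_le_bound _ (by positivity) fun v => ?_
    rw [hf, hG.expConj_exp, norm_mul, ← norm_inv, ← Complex.exp_neg]
    have : ‖fderiv ℝ G ζ (Complex.exp (-ζ) * v)‖ ≤ M * (‖Complex.exp (-ζ)‖ * ‖v‖) := by
      rw [← norm_mul]
      exact (ContinuousLinearMap.le_opNorm _ _).trans (by
        gcongr; exact norm_fderiv_le_of_lipschitz ℝ hM)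
    calc _ ≤ ‖Complex.exp (G ζ)‖ * (M * (‖Complex.exp (-ζ)‖ * ‖v‖)) := by gcongr
      _ = _ := by ring
  · obtain ⟨e1, e2⟩ := wirtingerDz_comp_mul hf
    rw [e1, e2, norm_mul, norm_mul, norm_mul, norm_mul, RCLike.norm_conj]
    calc _ ≤ ‖Complex.exp (G ζ)‖ * ‖Complex.exp (-ζ)‖ * (k * ‖wirtingerDz G ζ‖) := by
          gcongr; exact hgood.2
      _ = _ := by ring

/-- The centre is deformed from z₀ to 0 along u z₀. Injectivity keeps the difference nonzero, so it
has a continuous logarithm on the whole (u, t)-plane. The increment of that logarithm over a period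
is a continuous function of u with values in 2πiℤ up to a constant, hence constant. At u = 0 a
logarithm is `G (log r + t i)`, which gains 2πi by `add_period`. -/
theorem windsOnceAround_expConj (hG : IsQCLogLift k G) (z₀ : ℂ) {r : ℝ} (hr : 0 < r) :
    WindsOnceAround (expConj G) z₀ r := by
  set F := expConj G with hF
  have hFc : Continuous F := hG.continuous_expConj
  let f : C(ℝ × ℝ, ℂ) := ⟨fun p => F (circleMap (p.1 * z₀) r p.2) - F (p.1 * z₀), by
    have : Continuous fun p : ℝ × ℝ => circleMap (p.1 * z₀) r p.2 := by
      unfold circleMap; fun_prop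
    fun_prop⟩
  have hf : ∀ p, f p ∈ ({0}ᶜ : Set ℂ) := by
    intro p h
    exact circleMap_ne_center hr.ne' (hG.bijective_expConj.1 (sub_eq_zero.1 h))
  obtain ⟨Θ, ⟨-, hΘ⟩, -⟩ := Complex.isCoveringMapOn_exp.existsUnique_continuousMap_lifts f
    (a₀ := (0, 0)) (Complex.exp_log (hf (0, 0))) hf
  have hΘ' : ∀ p, Complex.exp (Θ p) = f p := fun p => congrFun hΘ p
  -- Two continuous logarithms of one function differ by a continuous 2πiℤ-valued function, constant
  -- on a connected space.
  have hconst : ∀ {X : Type} [TopologicalSpace X] [PreconnectedSpace X] (a b : X → ℂ),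
      Continuous a → Continuous b → (∀ x, Complex.exp (a x) = Complex.exp (b x)) →
      ∀ x y, a x - b x = a y - b y := by
    intro X _ _ a b ha hb hab x y
    have hrange : ∀ x, ∃ n : ℤ, a x - b x = n * (2 * Real.pi * Complex.I) := by
      intro x
      obtain ⟨n, hn⟩ := Complex.exp_eq_exp_iff_exists_int.1 (hab x)
      exact ⟨n, by rw [hn]; ring⟩
    choose n hn using hrange
    have hc : Continuous fun x => (n x : ℝ) := by
      have : (fun x => (n x : ℝ)) = fun x => ((a x - b x) / (2 * Real.pi * Complex.I)).re := by
        funext x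
        rw [hn x, mul_div_cancel_right₀ _ Complex.two_pi_I_ne_zero]
        simp
      rw [this]
      exact Complex.continuous_re.comp ((ha.sub hb).div_const _)
    have hc' : Continuous n := Int.isClosedEmbedding_coe_real.isEmbedding.continuous_iff.2 hc
    rw [hn x, hn y, PreconnectedSpace.constant ‹_› hc' (x := x) (y := y)]
  have hper : ∀ u t, f (u, t + 2 * Real.pi) = f (u, t) := by
    intro u t
    change F _ - _ = F _ - _
    rw [periodic_circleMap]
  have hinc : ∀ u : ℝ, Θ (u, 2 * Real.pi) - Θ (u, 0) = Θ (0, 2 * Real.pi) - Θ (0, 0) := by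
    intro u
    refine hconst (fun u => Θ (u, 2 * Real.pi)) (fun u => Θ (u, 0)) (by fun_prop) (by fun_prop)
      (fun u => ?_) u 0
    rw [hΘ', hΘ', ← hper u 0, zero_add]
  have hθ : ∀ t : ℝ, Complex.exp (Θ (0, t)) =
      Complex.exp (G (Real.log r + t * Complex.I)) := by
    intro t
    rw [hΘ', ← hG.expConj_exp, Complex.exp_add, ← Complex.ofReal_exp, Real.exp_log hr]
    change F _ - F _ = _
    simp [circleMap, hF]
  have h0 := hconst (fun t => Θ (0, t)) (fun t : ℝ => G (Real.log r + t * Complex.I))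
    (by fun_prop) (hG.continuous.comp (by fun_prop)) hθ (2 * Real.pi) 0
  have hp := hG.add_period (Real.log r)
  refine ⟨fun t => Θ (1, t), by fun_prop, fun t => ?_, ?_⟩
  · rw [hΘ']
    change F _ - F _ = _
    simp
  · have h1 := hinc 1
    simp only [Complex.ofReal_mul, Complex.ofReal_ofNat, Complex.ofReal_zero, zero_mul,
      add_zero] at h0
    rw [hp] at h0
    linear_combination h1 + h0

theorem isKQuasiconformalOn_expConj (hG : IsQCLogLift k G) :
    IsKQuasiconformalOn k univ (expConj G) := by
  obtain ⟨M, hM⟩ := hG.lipschitz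
  have hae := hG.ae_expConj hM
  have hweak := hasWeakDz_univ_of_lipschitzNear (F := expConj G)
    (B := fun w => M * ‖expConj G w‖) hG.continuous_expConj
    (fun z hz => hG.lipschitzNear_expConj hz) (hae.mono fun w hw => hw.1)
    (continuous_const.mul hG.continuous_expConj.norm) (hae.mono fun w hw => hw.2.1)
  refine ⟨⟨?_, fun z₀ r hr _ => hG.windsOnceAround_expConj z₀ hr⟩, _, _, hweak.1, hweak.2, ?_⟩
  · exact hG.homeomorph.isOpenEmbedding.comp isOpen_univ.isOpenEmbedding_subtypeVal
  · rw [Measure.restrict_univ]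
    exact hae.mono fun w hw => hw.2.2

theorem wirtinger_neg_comp_neg (G : ℂ → ℂ) (ζ : ℂ) :
    wirtingerDz (fun z => -G (-z)) ζ = wirtingerDz G (-ζ) ∧
      wirtingerDzbar (fun z => -G (-z)) ζ = wirtingerDzbar G (-ζ) := by
  have h : fderiv ℝ (fun z => -G (-z)) ζ = fderiv ℝ G (-ζ) := by
    have := fderiv_comp_smul (𝕜 := ℝ) (f := G) (x := ζ) (-1)
    simp only [neg_smul, one_smul] at this
    rw [fderiv_fun_neg, this, neg_neg]
  simp [wirtingerDz, wirtingerDzbar, h]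

/-- Conjugating by w ↦ 1/w turns a map with lift G into one with lift -G(-ζ), which reduces the
point at infinity to the origin. -/
theorem neg_comp_neg (hG : IsQCLogLift k G) : IsQCLogLift k (fun ζ => -G (-ζ)) where
  lipschitz := by
    obtain ⟨M, hM⟩ := hG.lipschitz
    refine ⟨M, LipschitzWith.of_dist_le_mul fun x y => ?_⟩
    simpa using hM.dist_le_mul (-x) (-y)
  bijective := (Equiv.neg ℂ).bijective.comp (hG.bijective.comp (Equiv.neg ℂ).bijective)
  add_period ζ := by
    have := hG.add_period (-(ζ + 2 * Real.pi * Complex.I))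
    rw [show -(ζ + 2 * Real.pi * Complex.I) + 2 * Real.pi * Complex.I = -ζ by ring] at this
    rw [this]; ring
  tendsto_atBot := by
    have h : Tendsto (fun ζ : ℂ => -ζ) (comap Complex.re atBot) (comap Complex.re atTop) := by
      rw [tendsto_comap_iff]
      exact tendsto_neg_atBot_atTop.comp tendsto_comap
    exact tendsto_neg_atTop_atBot.comp (hG.tendsto_atTop.comp h)
  tendsto_atTop := by
    have h : Tendsto (fun ζ : ℂ => -ζ) (comap Complex.re atTop) (comap Complex.re atBot) := by
      rw [tendsto_comap_iff]
      exact tendsto_neg_atTop_atBot.comp tendsto_comap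
    exact tendsto_neg_atBot_atTop.comp (hG.tendsto_atBot.comp h)
  ae_le := by
    have h := (Measure.measurePreserving_neg (volume : Measure ℂ)).quasiMeasurePreserving.ae
      hG.ae_le
    filter_upwards [h] with ζ hζ
    rw [(wirtinger_neg_comp_neg G ζ).1, (wirtinger_neg_comp_neg G ζ).2]
    refine ⟨?_, hζ.2⟩
    have h1 : DifferentiableAt ℝ (fun z : ℂ => -z) ζ := by fun_prop
    exact (DifferentiableAt.comp ζ hζ.1 h1).neg

theorem isKQuasiconformalSphere (hG : IsQCLogLift k G) :
    IsKQuasiconformalSphere k hG.homeomorph.onePointCongr := by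
  intro P
  induction P using OnePoint.rec with
  | infty =>
    refine ⟨_, _, Or.inr rfl, Or.inr rfl, univ, expConj fun ζ => -G (-ζ), isOpen_univ,
      ⟨0, mem_univ _, by simp [sphereParamInfty]⟩, fun w _ => ?_,
      hG.neg_comp_neg.isKQuasiconformalOn_expConj⟩
    by_cases hw : w = 0
    · simp [hw, sphereParamInfty]
    · have h1 : expConj (fun ζ => -G (-ζ)) w ≠ 0 := mt expConj_eq_zero_iff.1 hw
      simp only [sphereParamInfty, hw, h1, if_false]
      change ((expConj G w⁻¹ : ℂ) : OnePoint ℂ) = _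
      congr 1
      rw [expConj_of_ne_zero _ hw, ← Complex.exp_neg, neg_neg, ← hG.expConj_exp,
        Complex.exp_neg, Complex.exp_log hw]
  | coe z =>
    exact ⟨_, _, Or.inl rfl, Or.inl rfl, univ, expConj G, isOpen_univ, ⟨z, mem_univ _, rfl⟩,
      fun w _ => rfl, hG.isKQuasiconformalOn_expConj⟩

end IsQCLogLift

/-! ### The Apollonius disk of slopes -/

/-- Squaring the hypothesis gives (1 - k²)(1 + |β|²) ≤ 2(1 + k²) Re β; the term |β|² is dropped. -/
theorem re_ge_of_norm_sub_one_le {k : ℝ} (hk0 : 0 ≤ k) (hk1 : k < 1) {β : ℂ}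
    (hβ : ‖β - 1‖ ≤ k * ‖β + 1‖) : (1 - k ^ 2) / (2 * (1 + k ^ 2)) ≤ β.re := by
  have h2 : ‖β - 1‖ ^ 2 ≤ k ^ 2 * ‖β + 1‖ ^ 2 := by
    rw [← mul_pow]; gcongr
  rw [Complex.sq_norm, Complex.sq_norm, Complex.normSq_apply, Complex.normSq_apply] at h2
  simp only [Complex.sub_re, Complex.sub_im, Complex.add_re, Complex.add_im, Complex.one_re,
    Complex.one_im, sub_zero, add_zero] at h2
  rw [div_le_iff₀ (by positivity)]
  have hk : k ^ 2 ≤ 1 := by nlinarith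
  nlinarith [mul_nonneg (sub_nonneg.2 hk)
    (add_nonneg (mul_self_nonneg β.re) (mul_self_nonneg β.im))]

theorem norm_le_of_norm_sub_one_le {k : ℝ} (hk0 : 0 ≤ k) (hk1 : k < 1) {β : ℂ}
    (hβ : ‖β - 1‖ ≤ k * ‖β + 1‖) : ‖β‖ ≤ (1 + k) / (1 - k) := by
  rw [le_div_iff₀ (by linarith)]
  have h1 : ‖β‖ - 1 ≤ ‖β - 1‖ := by simpa using norm_sub_norm_le β 1
  have h2 : ‖β + 1‖ ≤ ‖β‖ + 1 := by simpa using norm_add_le β 1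
  nlinarith

theorem re_pos_of_norm_sub_one_le {k : ℝ} (hk0 : 0 ≤ k) (hk1 : k < 1) {β : ℂ}
    (hβ : ‖β - 1‖ ≤ k * ‖β + 1‖) : 0 < β.re :=
  lt_of_lt_of_le (div_pos (by nlinarith) (by positivity)) (re_ge_of_norm_sub_one_le hk0 hk1 hβ)

/-! ### Extension by parallel rays to the right half-plane -/

/-- A function on the closed left half-plane, holomorphic inside, commuting with translation by
`2πi` and whose difference quotients lie in the disk `{b | ‖b - a‖ ≤ k * ‖b + a‖}`. -/
structure IsHalfPlaneLift (k : ℝ) (a : ℂ) (g : ℂ → ℂ) : Prop where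
  slope : ∀ x y : ℂ, x.re ≤ 0 → y.re ≤ 0 →
    ∃ β : ℂ, ‖β - 1‖ ≤ k * ‖β + 1‖ ∧ g x - g y = a * β * (x - y)
  add_period : ∀ x : ℂ, x.re ≤ 0 →
    g (x + 2 * Real.pi * Complex.I) = g x + 2 * Real.pi * Complex.I
  differentiableAt : ∀ x : ℂ, x.re < 0 → DifferentiableAt ℂ g x
  bounded : ∃ C : ℝ, ∀ x : ℂ, x.re ≤ -1 → |(g x).re - x.re| ≤ C

/-- The horizontal projection onto the closed left half-plane. -/
noncomputable def leftProj (ζ : ℂ) : ℂ := ⟨min ζ.re 0, ζ.im⟩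

/-- The extension of `g` to the plane which is affine of slope `a` on horizontal rays in the right
half-plane. -/
noncomputable def rayExtension (a : ℂ) (g : ℂ → ℂ) (ζ : ℂ) : ℂ :=
  g (leftProj ζ) + a * (max ζ.re 0 : ℝ)

theorem leftProj_re_le (ζ : ℂ) : (leftProj ζ).re ≤ 0 := min_le_right _ _

theorem leftProj_add (ζ : ℂ) : leftProj ζ + (max ζ.re 0 : ℝ) = ζ := by
  apply Complex.ext
  · simp [leftProj, min_add_max]
  · simp [leftProj]

theorem leftProj_of_le {ζ : ℂ} (h : ζ.re ≤ 0) : leftProj ζ = ζ := by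
  apply Complex.ext <;> simp [leftProj, h]

theorem leftProj_of_ge {ζ : ℂ} (h : 0 ≤ ζ.re) : leftProj ζ = ζ.im * Complex.I := by
  apply Complex.ext <;> simp [leftProj, h]

theorem norm_leftProj_sub_le (x y : ℂ) : ‖leftProj x - leftProj y‖ ≤ ‖x - y‖ := by
  rw [← sq_le_sq₀ (norm_nonneg _) (norm_nonneg _), Complex.sq_norm, Complex.sq_norm,
    Complex.normSq_apply, Complex.normSq_apply]
  have : |min x.re 0 - min y.re 0| ≤ |x.re - y.re| := by
    refine (abs_min_sub_min_le_max _ _ _ _).trans ?_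
    simp
  have := sq_le_sq.2 this
  simp only [leftProj, Complex.sub_re, Complex.sub_im]
  nlinarith

theorem rayExtension_of_le (a : ℂ) (g : ℂ → ℂ) {ζ : ℂ} (h : ζ.re ≤ 0) :
    rayExtension a g ζ = g ζ := by
  simp [rayExtension, leftProj_of_le h, h]

theorem rayExtension_of_ge (a : ℂ) (g : ℂ → ℂ) {ζ : ℂ} (h : 0 ≤ ζ.re) :
    rayExtension a g ζ = g (ζ.im * Complex.I) + a * ζ.re := by
  simp [rayExtension, leftProj_of_ge h, h]

namespace IsHalfPlaneLift

variable {k : ℝ} {a : ℂ} {g : ℂ → ℂ}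

/-- The slope across one full period is 1, so 1/a itself satisfies the slope inequality and has
positive real part. -/
theorem re_pos (hg : IsHalfPlaneLift k a g) (hk0 : 0 ≤ k) (hk1 : k < 1) : 0 < a.re := by
  obtain ⟨β, hβ, h⟩ := hg.slope (0 + 2 * Real.pi * Complex.I) 0 (by simp) (by simp)
  rw [hg.add_period 0 (by simp)] at h
  have hab : a * β = 1 := by
    have := Complex.two_pi_I_ne_zero
    apply mul_right_cancel₀ this
    linear_combination -h
  have hre := re_pos_of_norm_sub_one_le hk0 hk1 hβ
  have hβ0 : β ≠ 0 := by rintro rfl; simp at hre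
  rw [eq_inv_of_mul_eq_one_left hab, Complex.inv_re]
  exact div_pos hre (Complex.normSq_pos.2 hβ0)

theorem ne_zero (hg : IsHalfPlaneLift k a g) (hk0 : 0 ≤ k) (hk1 : k < 1) : a ≠ 0 := by
  have := hg.re_pos hk0 hk1
  rintro rfl; simp at this

theorem norm_sub_le (hg : IsHalfPlaneLift k a g) (hk0 : 0 ≤ k) (hk1 : k < 1) {x y : ℂ}
    (hx : x.re ≤ 0) (hy : y.re ≤ 0) :
    ‖g x - g y‖ ≤ ‖a‖ * ((1 + k) / (1 - k)) * ‖x - y‖ := by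
  obtain ⟨β, hβ, h⟩ := hg.slope x y hx hy
  rw [h, norm_mul, norm_mul]
  gcongr
  exact norm_le_of_norm_sub_one_le hk0 hk1 hβ

theorem lipschitz_rayExtension (hg : IsHalfPlaneLift k a g) (hk0 : 0 ≤ k) (hk1 : k < 1) :
    ∃ M, LipschitzWith M (rayExtension a g) := by
  have h1k : 0 < 1 - k := by linarith
  refine ⟨⟨‖a‖ * ((1 + k) / (1 - k)) + ‖a‖, by positivity⟩, LipschitzWith.of_dist_le_mul ?_⟩
  intro x y
  rw [dist_eq_norm, dist_eq_norm]
  have h1 := hg.norm_sub_le hk0 hk1 (leftProj_re_le x) (leftProj_re_le y)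
  have h2 : ‖a * (max x.re 0 : ℝ) - a * (max y.re 0 : ℝ)‖ ≤ ‖a‖ * ‖x - y‖ := by
    rw [← mul_sub, norm_mul, ← Complex.ofReal_sub, Complex.norm_real, Real.norm_eq_abs]
    gcongr
    calc |max x.re 0 - max y.re 0| ≤ |x.re - y.re| := by
          refine (abs_max_sub_max_le_max _ _ _ _).trans ?_
          simp
      _ ≤ ‖x - y‖ := by simpa using Complex.abs_re_le_norm (x - y)
  have h3 := norm_leftProj_sub_le x y
  calc ‖rayExtension a g x - rayExtension a g y‖
      = ‖(g (leftProj x) - g (leftProj y)) +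
          (a * (max x.re 0 : ℝ) - a * (max y.re 0 : ℝ))‖ := by
        rw [rayExtension, rayExtension]; congr 1; ring
    _ ≤ ‖a‖ * ((1 + k) / (1 - k)) * ‖x - y‖ + ‖a‖ * ‖x - y‖ := by
        refine (norm_add_le _ _).trans (add_le_add (h1.trans ?_) h2)
        gcongr
    _ = _ := by rw [← add_mul]; rfl

/-- Let τ ≥ 0 be the difference of the distances travelled along the rays. Equal values force β(p' -
q') = -τ for the projections p', q'. If τ > 0, then p' lies on the imaginary axis, so Re(p' - q') ≥
0, whereas Re(-τ/β) < 0. Hence τ = 0 and p' = q'. -/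
theorem injective_rayExtension (hg : IsHalfPlaneLift k a g) (hk0 : 0 ≤ k) (hk1 : k < 1) :
    Function.Injective (rayExtension a g) := by
  have ha := hg.ne_zero hk0 hk1
  have key : ∀ p q : ℂ, max q.re 0 ≤ max p.re 0 → rayExtension a g p = rayExtension a g q →
      p = q := by
    intro p q hle h
    obtain ⟨β, hβ, hs⟩ := hg.slope _ _ (leftProj_re_le p) (leftProj_re_le q)
    have hre := re_pos_of_norm_sub_one_le hk0 hk1 hβ
    have hβ0 : β ≠ 0 := by rintro rfl; simp at hre
    have h1 : a * (β * (leftProj p - leftProj q) +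
        ((max p.re 0 : ℝ) - (max q.re 0 : ℝ) : ℂ)) = 0 := by
      rw [rayExtension, rayExtension] at h
      linear_combination h - hs
    have h2 := (mul_eq_zero.1 h1).resolve_left ha
    set τ : ℝ := max p.re 0 - max q.re 0 with hτ
    have hτ' : ((max p.re 0 : ℝ) - (max q.re 0 : ℝ) : ℂ) = τ := by rw [hτ]; push_cast; ring
    rw [hτ'] at h2
    have hτ0 : τ = 0 := by
      by_contra hne
      have hpos : 0 < τ := lt_of_le_of_ne (sub_nonneg.2 hle) (Ne.symm hne)
      have hp : 0 < p.re := by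
        by_contra hp
        rw [hτ, max_eq_right (not_lt.1 hp)] at hpos
        linarith [le_max_right q.re 0]
      have hs' : leftProj p - leftProj q = -τ * β⁻¹ := by
        field_simp
        linear_combination h2
      have hre' := congrArg Complex.re hs'
      have e1 : (leftProj p).re = 0 := by simp [leftProj, hp.le]
      rw [← Complex.ofReal_neg, Complex.re_ofReal_mul, Complex.inv_re, Complex.sub_re, e1] at hre'
      have e2 := leftProj_re_le q
      have e3 : 0 < τ * (β.re / Complex.normSq β) :=
        mul_pos hpos (div_pos hre (Complex.normSq_pos.2 hβ0))
      linarith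
    rw [hτ0, Complex.ofReal_zero, add_zero] at h2
    have h3 := sub_eq_zero.1 ((mul_eq_zero.1 h2).resolve_left hβ0)
    rw [← leftProj_add p, ← leftProj_add q, h3, sub_eq_zero.1 (hτ.symm.trans hτ0)]
  intro p q h
  rcases le_total (max q.re 0) (max p.re 0) with hle | hle
  · exact key p q hle h
  · exact (key q p hle h.symm).symm

theorem continuous_rayExtension (hg : IsHalfPlaneLift k a g) (hk0 : 0 ≤ k) (hk1 : k < 1) :
    Continuous (rayExtension a g) :=
  (hg.lipschitz_rayExtension hk0 hk1).choose_spec.continuous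

theorem continuous_boundary (hg : IsHalfPlaneLift k a g) (hk0 : 0 ≤ k) (hk1 : k < 1) :
    Continuous fun η : ℝ => g (η * Complex.I) := by
  have : (fun η : ℝ => g (η * Complex.I)) = fun η : ℝ => rayExtension a g (η * Complex.I) := by
    funext η
    rw [rayExtension_of_le]; simp
  rw [this]
  exact (hg.continuous_rayExtension hk0 hk1).comp (by fun_prop)

/-- Along the boundary curve, Im(g/a) grows at rate at least m, the lower bound for Re β. It
therefore takes every real value, so every line of direction a meets the curve. -/
theorem exists_boundary_add (hg : IsHalfPlaneLift k a g) (hk0 : 0 ≤ k) (hk1 : k < 1) (p : ℂ) :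
    ∃ η t : ℝ, p = g (η * Complex.I) + a * t := by
  have ha := hg.ne_zero hk0 hk1
  set m := (1 - k ^ 2) / (2 * (1 + k ^ 2)) with hm
  have hm0 : 0 < m := div_pos (by nlinarith) (by positivity)
  set Y : ℝ → ℝ := fun η => (g (η * Complex.I) / a).im with hY
  have hYc : Continuous Y :=
    Complex.continuous_im.comp ((hg.continuous_boundary hk0 hk1).div_const a)
  have hslope : ∀ η η' : ℝ, η' ≤ η → m * (η - η') ≤ Y η - Y η' := by
    intro η η' hle
    obtain ⟨β, hβ, h⟩ := hg.slope (η * Complex.I) (η' * Complex.I) (by simp) (by simp)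
    have e : Y η - Y η' = β.re * (η - η') := by
      have : g (η * Complex.I) / a - g (η' * Complex.I) / a =
          ((η - η' : ℝ) : ℂ) * (β * Complex.I) := by
        rw [← sub_div, h]; field_simp; push_cast; ring
      rw [hY]
      simp only [← Complex.sub_im]
      rw [this, Complex.im_ofReal_mul]
      simp [mul_comm]
    rw [e]
    exact mul_le_mul_of_nonneg_right (re_ge_of_norm_sub_one_le hk0 hk1 hβ) (by linarith)
  have htop : Tendsto Y atTop atTop := by
    refine tendsto_atTop_mono' atTop ?_
      (tendsto_atTop_add_const_right _ (Y 0) (tendsto_id.const_mul_atTop hm0))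
    filter_upwards [eventually_ge_atTop 0] with η hη
    have := hslope η 0 hη
    simp only [id]
    linarith
  have hbot : Tendsto Y atBot atBot := by
    refine tendsto_atBot_mono' atBot ?_
      (tendsto_atBot_add_const_right _ (Y 0) (tendsto_id.const_mul_atBot hm0))
    filter_upwards [eventually_le_atBot 0] with η hη
    have := hslope 0 η hη
    simp only [id]
    linarith
  obtain ⟨η, hη⟩ := hYc.surjective htop hbot (p / a).im
  refine ⟨η, (p / a).re - (g (η * Complex.I) / a).re, ?_⟩
  have : p / a = g (η * Complex.I) / a + (((p / a).re - (g (η * Complex.I) / a).re : ℝ) : ℂ) := by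
    apply Complex.ext
    · simp
    · simp only [Complex.add_im, Complex.ofReal_im, add_zero]
      exact hη.symm
  field_simp at this ⊢
  exact this

/-- Open mapping theorem; injectivity excludes local constancy. -/
theorem isOpen_image (hg : IsHalfPlaneLift k a g) (hk0 : 0 ≤ k) (hk1 : k < 1) :
    IsOpen (g '' {x | x.re < 0}) := by
  have ho : IsOpen {x : ℂ | x.re < 0} := isOpen_lt Complex.continuous_re continuous_const
  rw [isOpen_iff_mem_nhds]
  rintro _ ⟨x, hx, rfl⟩
  have han : AnalyticAt ℂ g x := by
    have hd : DifferentiableOn ℂ g {x | x.re < 0} := fun y hy =>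
      (hg.differentiableAt y hy).differentiableWithinAt
    exact hd.analyticAt (ho.mem_nhds hx)
  rcases han.eventually_constant_or_nhds_le_map_nhds with h | h
  · exfalso
    have h' : ∀ᶠ z in 𝓝 x, z = x := by
      filter_upwards [h, ho.mem_nhds hx] with z hz hz0
      apply hg.injective_rayExtension hk0 hk1
      rw [rayExtension_of_le a g (le_of_lt hz0), rayExtension_of_le a g (le_of_lt hx), hz]
    have h2 : ∀ᶠ z in 𝓝[≠] x, z = x := h'.filter_mono nhdsWithin_le_nhds
    have h3 : ∀ᶠ z in 𝓝[≠] x, z ≠ x := self_mem_nhdsWithin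
    obtain ⟨z, h4, h5⟩ := (h2.and h3).exists
    exact h5 h4
  · exact h (image_mem_map (ho.mem_nhds hx))

/-- The slopes are bounded above and away from zero, so g is bi-Lipschitz on a complete set. -/
theorem isClosed_image (hg : IsHalfPlaneLift k a g) (hk0 : 0 ≤ k) (hk1 : k < 1) :
    IsClosed (g '' {x | x.re ≤ 0}) := by
  have ha := hg.ne_zero hk0 hk1
  have ha' : 0 < ‖a‖ := norm_pos_iff.2 ha
  have hc : IsClosed {x : ℂ | x.re ≤ 0} := isClosed_le Complex.continuous_re continuous_const
  set m := (1 - k ^ 2) / (2 * (1 + k ^ 2)) with hm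
  have hm0 : 0 < m := div_pos (by nlinarith) (by positivity)
  have : CompleteSpace {x : ℂ | x.re ≤ 0} := hc.completeSpace_coe
  have h1k : 0 < 1 - k := by linarith
  have hu : LipschitzWith ⟨‖a‖ * ((1 + k) / (1 - k)), by positivity⟩
      ({x : ℂ | x.re ≤ 0}.domRestrict g) := by
    refine LipschitzWith.of_dist_le_mul fun x y => ?_
    rw [dist_eq_norm, Subtype.dist_eq, dist_eq_norm]
    exact hg.norm_sub_le hk0 hk1 x.2 y.2
  have hanti : AntilipschitzWith ⟨(‖a‖ * m)⁻¹, by positivity⟩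
      ({x : ℂ | x.re ≤ 0}.domRestrict g) := by
    refine AntilipschitzWith.of_le_mul_dist fun x y => ?_
    obtain ⟨β, hβ, h⟩ := hg.slope x y x.2 y.2
    rw [dist_eq_norm, Subtype.dist_eq, dist_eq_norm]
    change _ ≤ (‖a‖ * m)⁻¹ * ‖g x - g y‖
    rw [h, norm_mul, norm_mul, inv_mul_eq_div, le_div_iff₀ (by positivity)]
    have : m ≤ ‖β‖ := (re_ge_of_norm_sub_one_le hk0 hk1 hβ).trans (Complex.re_le_norm β)
    calc _ = ‖a‖ * m * ‖(x : ℂ) - y‖ := by ring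
      _ ≤ _ := by gcongr
  have := hanti.isClosed_range hu.uniformContinuous
  rwa [range_domRestrict] at this

/-- Every point is g(iη) + at, and t ≥ 0 is covered by a ray. The points with t < 0 form the
connected set `Ω`, in which the image of the open left half-plane is nonempty, open and relatively
closed, hence everything. -/
theorem surjective_rayExtension (hg : IsHalfPlaneLift k a g) (hk0 : 0 ≤ k) (hk1 : k < 1) :
    Function.Surjective (rayExtension a g) := by
  have hinj := hg.injective_rayExtension hk0 hk1
  have hright : ∀ η t : ℝ, 0 ≤ t →
      rayExtension a g (t + η * Complex.I) = g (η * Complex.I) + a * t := by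
    intro η t ht
    rw [rayExtension_of_ge a g (by simpa using ht)]; simp
  have hleft : ∀ x : ℂ, x.re ≤ 0 → rayExtension a g x = g x := fun x hx =>
    rayExtension_of_le a g hx
  set Ω : Set ℂ := (fun p : ℝ × ℝ => g (p.2 * Complex.I) + a * p.1) '' (Iio 0 ×ˢ univ) with hΩ
  have hΩc : IsPreconnected Ω := by
    refine ((convex_Iio 0).prod convex_univ).isPreconnected.image _ (Continuous.continuousOn ?_)
    have := (hg.continuous_boundary hk0 hk1).comp (continuous_snd (X := ℝ) (Y := ℝ))
    exact this.add (by fun_prop)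
  have hU : g '' {x | x.re < 0} ⊆ Ω := by
    rintro _ ⟨x, hx, rfl⟩
    obtain ⟨η, t, ht⟩ := hg.exists_boundary_add hk0 hk1 (g x)
    refine ⟨(t, η), ⟨?_, mem_univ _⟩, ht.symm⟩
    by_contra hneg
    have ht0 : 0 ≤ t := not_lt.1 hneg
    rw [← hright η t ht0, ← hleft x (le_of_lt hx)] at ht
    have := congrArg Complex.re (hinj ht)
    simp at this
    have hx' : x.re < 0 := hx
    linarith
  have hΩU : Ω ⊆ g '' {x | x.re < 0} := by
    refine hΩc.subset_left_of_subset_union (hg.isOpen_image hk0 hk1)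
      (hg.isClosed_image hk0 hk1).isOpen_compl ?_ ?_ ?_
    · rw [disjoint_compl_right_iff_subset]
      exact image_mono fun x (hx : x.re < 0) => (le_of_lt hx : x.re ≤ 0)
    · rintro _ ⟨⟨t, η⟩, ⟨ht, -⟩, rfl⟩
      by_cases hC : g (η * Complex.I) + a * t ∈ g '' {x | x.re ≤ 0}
      · left
        obtain ⟨x, hx, hxe⟩ := hC
        rcases lt_or_eq_of_le (show x.re ≤ 0 from hx) with h | h
        · exact ⟨x, h, hxe⟩
        -- If g(x) with x on the axis equalled g(iη) + at with t < 0, the ray from x would reach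
        -- g(iη) after the distance -t, contradicting injectivity.
        · exfalso
          have ht' : t < 0 := ht
          have hx' : x = x.im * Complex.I := by apply Complex.ext <;> simp [h]
          have e1 := hright x.im (-t) (by linarith)
          rw [← hx', hxe] at e1
          have e2 : rayExtension a g ((-t : ℝ) + x) = rayExtension a g (η * Complex.I) := by
            rw [e1, hleft _ (by simp)]; push_cast; ring
          have := congrArg Complex.re (hinj e2)
          simp [h] at this
          linarith
      · exact Or.inr hC
    · exact ⟨g (-1), hU ⟨-1, by simp, rfl⟩, ⟨-1, by simp, rfl⟩⟩
  intro p
  obtain ⟨η, t, rfl⟩ := hg.exists_boundary_add hk0 hk1 p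
  rcases le_or_gt 0 t with ht | ht
  · exact ⟨_, hright η t ht⟩
  · obtain ⟨x, hx, hxe⟩ := hΩU ⟨(t, η), ⟨ht, mem_univ _⟩, rfl⟩
    exact ⟨x, (hleft x (le_of_lt hx)).trans hxe⟩

/-- On the left the map is holomorphic. On the right the real direction has derivative a and the
quotients in the direction i are aβi. The inequality |β - 1| ≤ k|β + 1| is closed and passes to the
limit, even if β itself is not followed. -/
theorem wirtinger_rayExtension_le (hg : IsHalfPlaneLift k a g) (hk0 : 0 ≤ k) {ζ : ℂ}
    (hζ : ζ.re ≠ 0) (hd : DifferentiableAt ℝ (rayExtension a g) ζ) :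
    ‖wirtingerDzbar (rayExtension a g) ζ‖ ≤ k * ‖wirtingerDz (rayExtension a g) ζ‖ := by
  rcases lt_or_gt_of_ne hζ with hneg | hpos
  · have heq : rayExtension a g =ᶠ[𝓝 ζ] g := by
      filter_upwards [(isOpen_lt Complex.continuous_re continuous_const).mem_nhds hneg] with z hz
      exact rayExtension_of_le a g (le_of_lt hz)
    have h1 := ((hg.differentiableAt ζ hneg).hasDerivAt.hasFDerivAt.restrictScalars
      ℝ).congr_of_eventuallyEq heq
    have : wirtingerDzbar (rayExtension a g) ζ = 0 := by
      rw [wirtingerDzbar, h1.fderiv]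
      simp only [ContinuousLinearMap.coe_restrictScalars', ContinuousLinearMap.toSpanSingleton_apply,
        smul_eq_mul]
      linear_combination (deriv g ζ / 2) * Complex.I_sq
    rw [this, norm_zero]
    positivity
  · have hline := fun v => (hd.hasFDerivAt.hasLineDerivAt v).tendsto_slope_zero
    have hnhds : ∀ v : ℂ, ∀ᶠ t : ℝ in 𝓝[≠] 0, 0 < (ζ + t • v).re := by
      intro v
      have hc : Continuous fun t : ℝ => (ζ + t • v).re := by fun_prop
      have : ∀ᶠ t : ℝ in 𝓝 0, 0 < (ζ + t • v).re :=
        hc.continuousAt.eventually (lt_mem_nhds (by simpa using hpos))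
      exact this.filter_mono nhdsWithin_le_nhds
    have hone : fderiv ℝ (rayExtension a g) ζ 1 = a := by
      refine tendsto_nhds_unique (hline 1) (tendsto_const_nhds.congr' ?_)
      filter_upwards [hnhds 1, self_mem_nhdsWithin] with t ht ht0
      have ht0' : (t : ℂ) ≠ 0 := Complex.ofReal_ne_zero.2 ht0
      rw [rayExtension_of_ge a g ht.le, rayExtension_of_ge a g hpos.le]
      simp
      field_simp
      ring
    have hI : ‖fderiv ℝ (rayExtension a g) ζ Complex.I - a * Complex.I‖ ≤
        k * ‖fderiv ℝ (rayExtension a g) ζ Complex.I + a * Complex.I‖ := by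
      refine le_of_tendsto_of_tendsto ((hline Complex.I).sub_const _).norm
        (((hline Complex.I).add_const _).norm.const_mul k) ?_
      filter_upwards [hnhds Complex.I, self_mem_nhdsWithin] with t ht ht0
      have ht0' : (t : ℂ) ≠ 0 := Complex.ofReal_ne_zero.2 ht0
      obtain ⟨β, hβ, h⟩ := hg.slope ((ζ.im + t : ℝ) * Complex.I) (ζ.im * Complex.I) (by simp)
        (by simp)
      have e : t⁻¹ • (rayExtension a g (ζ + t • Complex.I) - rayExtension a g ζ) =
          a * β * Complex.I := by
        rw [rayExtension_of_ge a g ht.le, rayExtension_of_ge a g hpos.le]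
        have i1 : (ζ + t • Complex.I).im = ζ.im + t := by simp
        have i2 : (ζ + t • Complex.I).re = ζ.re := by simp
        rw [i1, i2, add_sub_add_right_eq_sub, h, Complex.real_smul]
        push_cast
        field_simp
        ring
      rw [e, show a * β * Complex.I - a * Complex.I = a * Complex.I * (β - 1) by ring,
        show a * β * Complex.I + a * Complex.I = a * Complex.I * (β + 1) by ring,
        norm_mul (a * Complex.I), norm_mul (a * Complex.I)]
      calc _ ≤ ‖a * Complex.I‖ * (k * ‖β + 1‖) := by gcongr
        _ = _ := by ring
    rw [wirtingerDzbar, wirtingerDz, hone]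
    set E := fderiv ℝ (rayExtension a g) ζ Complex.I
    have e1 : a + Complex.I * E = Complex.I * (E - a * Complex.I) := by
      linear_combination a * Complex.I_sq
    have e2 : a - Complex.I * E = -Complex.I * (E + a * Complex.I) := by
      linear_combination a * Complex.I_sq
    rw [e1, e2, norm_div, norm_div, norm_mul, norm_mul, norm_neg, Complex.norm_I, one_mul, one_mul,
      mul_div_assoc']
    gcongr

theorem exists_re_rayExtension_bounds (hg : IsHalfPlaneLift k a g) (hk0 : 0 ≤ k) (hk1 : k < 1) :
    ∃ C : ℝ, (∀ ζ : ℂ, ζ.re ≤ -1 → (rayExtension a g ζ).re ≤ ζ.re + C) ∧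
      ∀ ζ : ℂ, 0 ≤ ζ.re → a.re * ζ.re - C ≤ (rayExtension a g ζ).re := by
  obtain ⟨C, hC⟩ := hg.bounded
  have h1k : 0 < 1 - k := by linarith
  set A := ‖a‖ * ((1 + k) / (1 - k)) with hA
  have hA0 : 0 ≤ A := by positivity
  refine ⟨C + 1 + A, fun ζ hζ => ?_, fun ζ hζ => ?_⟩
  · rw [rayExtension_of_le a g (by linarith)]
    linarith [(abs_le.1 (hC ζ hζ)).2]
  · rw [rayExtension_of_ge a g hζ, Complex.add_re, Complex.re_mul_ofReal]
    have h1 := hC (-1 + ζ.im * Complex.I) (by simp)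
    have h2 := hg.norm_sub_le hk0 hk1 (x := ζ.im * Complex.I) (y := -1 + ζ.im * Complex.I)
      (by simp) (by simp)
    have h3 := (Complex.abs_re_le_norm _).trans h2
    rw [Complex.sub_re] at h3
    have e : (ζ.im * Complex.I - (-1 + ζ.im * Complex.I) : ℂ) = 1 := by ring
    rw [e, norm_one, mul_one] at h3
    have e2 : (-1 + ζ.im * Complex.I : ℂ).re = -1 := by simp
    rw [e2] at h1
    linarith [(abs_le.1 h1).1, (abs_le.1 h3).1]

theorem ae_re_ne_zero : ∀ᵐ ζ : ℂ, ζ.re ≠ 0 := by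
  have h := Measure.addHaar_submodule (volume : Measure ℂ) (LinearMap.ker Complex.reLm) (by
    intro h
    have : (1 : ℂ) ∈ LinearMap.ker Complex.reLm := by rw [h]; trivial
    simp at this)
  rw [ae_iff]
  convert! h using 2
  ext z; simp

theorem isQCLogLift_rayExtension (hg : IsHalfPlaneLift k a g) (hk0 : 0 ≤ k) (hk1 : k < 1) :
    IsQCLogLift k (rayExtension a g) where
  lipschitz := hg.lipschitz_rayExtension hk0 hk1
  bijective := ⟨hg.injective_rayExtension hk0 hk1, hg.surjective_rayExtension hk0 hk1⟩
  add_period ζ := by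
    have e1 : leftProj (ζ + 2 * Real.pi * Complex.I) =
        leftProj ζ + 2 * Real.pi * Complex.I := by
      apply Complex.ext <;> simp [leftProj]
    have e2 : (ζ + 2 * Real.pi * Complex.I).re = ζ.re := by simp
    rw [rayExtension, rayExtension, e1, e2, hg.add_period _ (leftProj_re_le ζ)]
    ring
  tendsto_atBot := by
    obtain ⟨C, hC, -⟩ := hg.exists_re_rayExtension_bounds hk0 hk1
    refine tendsto_atBot_mono' _ ?_ (tendsto_atBot_add_const_right _ C tendsto_comap)
    filter_upwards [tendsto_comap.eventually_le_atBot (-1)] with ζ hζ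
    exact hC ζ hζ
  tendsto_atTop := by
    obtain ⟨C, -, hC⟩ := hg.exists_re_rayExtension_bounds hk0 hk1
    refine tendsto_atTop_mono' _ ?_ (tendsto_atTop_add_const_right _ (-C)
      (tendsto_comap.const_mul_atTop (hg.re_pos hk0 hk1)))
    filter_upwards [tendsto_comap.eventually_ge_atTop 0] with ζ hζ
    exact hC ζ hζ
  ae_le := by
    obtain ⟨M, hM⟩ := hg.lipschitz_rayExtension hk0 hk1
    filter_upwards [hM.ae_differentiableAt, ae_re_ne_zero] with ζ hd hζ
    exact ⟨hd, hg.wirtinger_rayExtension_le hk0 hζ hd⟩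

end IsHalfPlaneLift

/-! ### The disk B and the logarithmic lift of f -/

/-- Rotate so that the centre is n > 0, and let s² = (n - r)(n + r). Membership |d - n| ≤ r reads
|d|² + s² ≤ 2n Re d, while the goal |d - s| ≤ k|d + s| reads (1 - k²)(|d|² + s²) ≤ 2(1 + k²) s Re d.
It therefore suffices that n(1 - k²) ≤ s(1 + k²). -/
theorem exists_disk_center {k : ℝ} (hk0 : 0 ≤ k) (hk1 : k < 1) {c : ℂ} {r : ℝ} (hr : 0 ≤ r)
    (hB0 : (0 : ℂ) ∉ closedBall c r)
    (hBK : ∀ w ∈ closedBall c r, ∀ z ∈ closedBall c r,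
      Real.sqrt ‖w / z‖ ≤ (1 + k) / (1 - k)) :
    ∃ a : ℂ, a ≠ 0 ∧ ∀ b ∈ closedBall c r, ‖b - a‖ ≤ k * ‖b + a‖ := by
  have hcr : r < ‖c‖ := by simpa using hB0
  have hc0 : 0 < ‖c‖ := hr.trans_lt hcr
  have hcne : c ≠ 0 := norm_pos_iff.1 hc0
  have h1k : 0 < 1 - k := by linarith
  set n := ‖c‖ with hn
  obtain ⟨u, hu, hcu⟩ : ∃ u : ℂ, ‖u‖ = 1 ∧ c = n * u := by
    refine ⟨c / n, ?_, ?_⟩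
    · rw [norm_div, Complex.norm_real, Real.norm_eq_abs, abs_of_pos hc0, ← hn, div_self hc0.ne']
    · have : (n : ℂ) ≠ 0 := Complex.ofReal_ne_zero.2 hc0.ne'
      field_simp
  have hu0 : u ≠ 0 := by rintro rfl; simp at hu
  -- The ratio bound is used only at the points of B with largest and smallest modulus.
  have hratio : (n + r) * (1 - k) ^ 2 ≤ (n - r) * (1 + k) ^ 2 := by
    have hw : (((n + r : ℝ) : ℂ) * u) ∈ closedBall c r := by
      rw [mem_closedBall, dist_eq_norm, hcu, ← sub_mul, norm_mul, hu, ← Complex.ofReal_sub,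
        Complex.norm_real, Real.norm_eq_abs, add_sub_cancel_left, abs_of_nonneg hr, mul_one]
    have hz : (((n - r : ℝ) : ℂ) * u) ∈ closedBall c r := by
      rw [mem_closedBall, dist_eq_norm, hcu, ← sub_mul, norm_mul, hu, ← Complex.ofReal_sub,
        Complex.norm_real, Real.norm_eq_abs, sub_sub_cancel_left, abs_neg, abs_of_nonneg hr, mul_one]
    have h := hBK _ hw _ hz
    rw [mul_div_mul_right _ _ hu0, ← Complex.ofReal_div, Complex.norm_real, Real.norm_eq_abs,
      abs_of_pos (div_pos (by linarith) (by linarith)), Real.sqrt_le_left (by positivity),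
      div_pow, div_le_div_iff₀ (by linarith) (by positivity)] at h
    linarith
  set s := Real.sqrt (n ^ 2 - r ^ 2) with hs
  have hs2 : s ^ 2 = n ^ 2 - r ^ 2 := Real.sq_sqrt (by nlinarith)
  have hs0 : 0 < s := Real.sqrt_pos.2 (by nlinarith)
  have hkey : n * (1 - k ^ 2) ≤ s * (1 + k ^ 2) := by
    have h1 : r * (1 + k ^ 2) ≤ 2 * k * n := by nlinarith
    have h2 : (n * (1 - k ^ 2)) ^ 2 ≤ (s * (1 + k ^ 2)) ^ 2 := by
      have h3 : (r * (1 + k ^ 2)) ^ 2 ≤ (2 * k * n) ^ 2 := by gcongr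
      rw [mul_pow s, hs2]
      nlinarith
    exact (le_abs_self _).trans (abs_le_of_sq_le_sq h2 (by positivity))
  refine ⟨s * u, mul_ne_zero (Complex.ofReal_ne_zero.2 hs0.ne') hu0, fun b hb => ?_⟩
  obtain ⟨d, rfl⟩ : ∃ d, b = d * u := ⟨b / u, by field_simp⟩
  rw [mem_closedBall, dist_eq_norm, hcu, ← sub_mul, norm_mul, hu, mul_one] at hb
  rw [← sub_mul, ← add_mul, norm_mul, norm_mul, hu, mul_one, mul_one]
  have hb2 : ‖d - n‖ ^ 2 ≤ r ^ 2 := by gcongr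
  refine (le_abs_self _).trans (abs_le_of_sq_le_sq ?_ (by positivity))
  rw [mul_pow, Complex.sq_norm, Complex.sq_norm, Complex.normSq_apply, Complex.normSq_apply]
  rw [Complex.sq_norm, Complex.normSq_apply] at hb2
  simp only [Complex.sub_re, Complex.sub_im, Complex.add_re, Complex.add_im, Complex.ofReal_re,
    Complex.ofReal_im, sub_zero, add_zero] at hb2 ⊢
  have hd : d.re * d.re + d.im * d.im + s ^ 2 ≤ 2 * n * d.re := by rw [hs2]; nlinarith
  have hd0 : 0 ≤ d.re := by
    by_contra hneg
    nlinarith [mul_self_nonneg d.re, mul_self_nonneg d.im, sq_nonneg s]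
  have hk2 : 0 ≤ 1 - k ^ 2 := by nlinarith
  nlinarith [mul_le_mul_of_nonneg_right hkey hd0, mul_le_mul_of_nonneg_right hd hk2]

/-- The quotient q = f(z)/z, with value f'(0) at 0, has no zeros in the disk. A primitive of q'/q,
normalised at 0, is a logarithm of q. -/
theorem exists_logarithm {f : ℂ → ℂ} (hf : DifferentiableOn ℂ f (ball 0 1)) (hf0 : f 0 = 0)
    (hf'0 : deriv f 0 ≠ 0) (hne : ∀ z ∈ ball (0 : ℂ) 1, z ≠ 0 → f z ≠ 0) :
    ∃ L : ℂ → ℂ, DifferentiableOn ℂ L (ball 0 1) ∧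
      ∀ z ∈ ball (0 : ℂ) 1, z * Complex.exp (L z) = f z := by
  have hb : ball (0 : ℂ) 1 ∈ 𝓝 0 := ball_mem_nhds _ one_pos
  set q := dslope f 0 with hq
  have hqd : DifferentiableOn ℂ q (ball 0 1) := (Complex.differentiableOn_dslope hb).2 hf
  have hqf : ∀ z, z * q z = f z := by
    intro z
    have := sub_smul_dslope f 0 z
    simpa [hf0] using this
  have hq0 : ∀ z ∈ ball (0 : ℂ) 1, q z ≠ 0 := by
    intro z hz h
    by_cases hz0 : z = 0
    · rw [hz0, hq, dslope_same] at h
      exact hf'0 h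
    · exact hne z hz hz0 (by rw [← hqf, h, mul_zero])
  have hh : DifferentiableOn ℂ (fun z => deriv q z / q z) (ball 0 1) :=
    (hqd.deriv isOpen_ball).div hqd hq0
  obtain ⟨L, hL0, hL⟩ := hh.isExactOn_ball.with_val_at 0 (Complex.log (q 0))
  have hLd : DifferentiableOn ℂ L (ball 0 1) := fun z hz =>
    (hL z hz).differentiableAt.differentiableWithinAt
  refine ⟨L, hLd, fun z hz => ?_⟩
  have hder : ∀ w ∈ ball (0 : ℂ) 1, HasDerivAt (fun w => q w * Complex.exp (-L w)) 0 w := by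
    intro w hw
    have h1 := (hqd.differentiableAt (isOpen_ball.mem_nhds hw)).hasDerivAt
    have h2 := h1.mul (hL w hw).neg.cexp
    convert! h2 using 1
    have := hq0 w hw
    field_simp
    ring
  have hconst := isOpen_ball.is_const_of_fderiv_eq_zero (𝕜 := ℂ)
    (convex_ball (0 : ℂ) 1).isPreconnected
    (fun w hw => (hder w hw).differentiableAt.differentiableWithinAt)
    (fun w hw => by
      rw [(hder w hw).hasFDerivAt.fderiv]; ext; simp) hz (mem_ball_self one_pos)
  rw [hL0, Complex.exp_neg, Complex.exp_neg,
    Complex.exp_log (hq0 0 (mem_ball_self one_pos)), mul_inv_cancel₀ (hq0 0 (mem_ball_self one_pos)),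
    mul_inv_eq_one₀ (Complex.exp_ne_zero _)] at hconst
  rw [← hconst, hqf]

/-- With L a logarithm of f(z)/z, the lift is ζ + L(e^ζ). The mean value inequality on the convex
half-plane, applied to the lift minus cζ, puts its difference quotients in B. -/
theorem exists_halfPlaneLift {k : ℝ} (hk0 : 0 ≤ k) {f : ℂ → ℂ} (hf : DifferentiableOn ℂ f (ball 0 1))
    (hf0 : f 0 = 0) (hf'0 : deriv f 0 ≠ 0) {a c : ℂ} {r : ℝ} (hr : 0 ≤ r)
    (hB0 : (0 : ℂ) ∉ closedBall c r) (ha0 : a ≠ 0)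
    (ha : ∀ b ∈ closedBall c r, ‖b - a‖ ≤ k * ‖b + a‖)
    (hfB : ∀ z ∈ ball (0 : ℂ) 1, z ≠ 0 → z * deriv f z / f z ∈ closedBall c r) :
    ∃ g : ℂ → ℂ, IsHalfPlaneLift k a g ∧
      ∀ ζ : ℂ, ζ.re < 0 → Complex.exp (g ζ) = f (Complex.exp ζ) := by
  have hne : ∀ z ∈ ball (0 : ℂ) 1, z ≠ 0 → f z ≠ 0 := by
    intro z hz hz0 h
    have := hfB z hz hz0
    -- At a zero of `f` the quotient has the default value 0, which is not in the disk.
    rw [h, div_zero] at this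
    exact hB0 this
  obtain ⟨L, hLd, hL⟩ := exists_logarithm hf hf0 hf'0 hne
  set H : Set ℂ := {ζ | ζ.re < 0} with hH
  have hHo : IsOpen H := isOpen_lt Complex.continuous_re continuous_const
  have hHc : Convex ℝ H := convex_halfSpace_re_lt 0
  have hHcl : closure H = {ζ | ζ.re ≤ 0} := Complex.closure_setOfPred_re_lt 0
  have hexp : ∀ ζ ∈ H, Complex.exp ζ ∈ ball (0 : ℂ) 1 := by
    intro ζ hζ
    rw [mem_ball_zero_iff, Complex.norm_exp]
    exact Real.exp_zero ▸ Real.exp_lt_exp.2 hζ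
  set g₀ : ℂ → ℂ := fun ζ => ζ + L (Complex.exp ζ) with hg₀
  have hg₀e : ∀ ζ ∈ H, Complex.exp (g₀ ζ) = f (Complex.exp ζ) := by
    intro ζ hζ
    rw [hg₀, Complex.exp_add, hL _ (hexp ζ hζ)]
  have hg₀d : ∀ ζ ∈ H, DifferentiableAt ℂ g₀ ζ := by
    intro ζ hζ
    have h1 := hLd.differentiableAt (isOpen_ball.mem_nhds (hexp ζ hζ))
    exact differentiableAt_id.add (h1.comp ζ Complex.differentiable_exp.differentiableAt)
  have hg₀' : ∀ ζ ∈ H, deriv g₀ ζ ∈ closedBall c r := by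
    intro ζ hζ
    have h1 := (hg₀d ζ hζ).hasDerivAt.cexp
    have h2 := HasDerivAt.comp ζ (hf.differentiableAt (isOpen_ball.mem_nhds (hexp ζ hζ))).hasDerivAt
      (Complex.hasDerivAt_exp ζ)
    have h3 := h1.unique (h2.congr_of_eventuallyEq (by
      filter_upwards [hHo.mem_nhds hζ] with w hw
      exact hg₀e w hw))
    have h4 := hfB _ (hexp ζ hζ) (Complex.exp_ne_zero ζ)
    have h5 := hne _ (hexp ζ hζ) (Complex.exp_ne_zero ζ)
    rw [hg₀e ζ hζ] at h3
    convert! h4 using 1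
    rw [eq_div_iff h5]
    linear_combination h3
  obtain ⟨R, hR⟩ : ∃ R : ℝ≥0, (R : ℝ) = r := ⟨⟨r, hr⟩, rfl⟩
  have hlip : LipschitzOnWith R (fun ζ => g₀ ζ - c * ζ) H := by
    refine hHc.lipschitzOnWith_of_nnnorm_hasDerivWithin_le (f' := fun ζ => deriv g₀ ζ - c)
      (fun ζ hζ => ?_) fun ζ hζ => ?_
    · have := (hg₀d ζ hζ).hasDerivAt.sub ((hasDerivAt_id ζ).const_mul c)
      rw [mul_one] at this
      exact this.hasDerivWithinAt
    · rw [← NNReal.coe_le_coe, coe_nnnorm, hR, ← dist_eq_norm]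
      exact hg₀' ζ hζ
  obtain ⟨u, hu, hueq⟩ := hlip.extend_finite_dimension
  -- The extension to the whole plane may have a larger constant. By continuity the sharp constant r
  -- survives on the closed half-plane, which is what keeps the slopes in B.
  have hul : LipschitzOnWith R u {ζ | ζ.re ≤ 0} := by
    rw [← hHcl]
    refine LipschitzOnWith.closure hu.continuous.continuousOn ?_
    intro x hx y hy
    rw [← hueq hx, ← hueq hy]
    exact hlip hx hy
  set g : ℂ → ℂ := fun ζ => u ζ + c * ζ with hg
  have hgc : Continuous g := hu.continuous.add (by fun_prop)
  have hgeq : EqOn g g₀ H := by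
    intro ζ hζ
    rw [hg]
    simp only [← hueq hζ]
    ring
  refine ⟨g, ⟨fun x y hx hy => ?_, ?_, fun x hx => ?_, ?_⟩, fun ζ hζ => ?_⟩
  · by_cases hxy : x - y = 0
    · rw [sub_eq_zero] at hxy
      -- For x = y any admissible β serves.
      exact ⟨1, by simp; positivity, by simp [hxy]⟩
    · have hd := hul.dist_le_mul x hx y hy
      rw [dist_eq_norm, dist_eq_norm, hR] at hd
      set b := (g x - g y) / (x - y) with hb
      have hbm : b ∈ closedBall c r := by
        rw [mem_closedBall, dist_eq_norm, hb]
        have : (g x - g y) / (x - y) - c = (u x - u y) / (x - y) := by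
          rw [hg]; field_simp; ring
        rw [this, norm_div, div_le_iff₀ (norm_pos_iff.2 hxy)]
        exact hd
      refine ⟨b / a, ?_, ?_⟩
      · have h := ha b hbm
        have e1 : b / a - 1 = (b - a) / a := by field_simp
        have e2 : b / a + 1 = (b + a) / a := by field_simp
        rw [e1, e2, norm_div, norm_div, mul_div_assoc']
        gcongr
      · rw [mul_div_cancel₀ _ ha0, hb, div_mul_cancel₀ _ hxy]
  · have hper : EqOn (fun x => g (x + 2 * Real.pi * Complex.I))
        (fun x => g x + 2 * Real.pi * Complex.I) H := by
      intro ζ hζ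
      have hζ' : ζ + 2 * Real.pi * Complex.I ∈ H := by
        have : ζ.re < 0 := hζ
        simpa [hH] using this
      simp only [hgeq hζ, hgeq hζ', hg₀]
      rw [Complex.exp_periodic ζ]
      ring
    have := hper.closure (hgc.comp (by fun_prop)) (hgc.add continuous_const)
    rw [hHcl] at this
    exact fun x hx => this hx
  · exact (hg₀d x hx).congr_of_eventuallyEq (hgeq.eventuallyEq_of_mem (hHo.mem_nhds hx))
  -- The difference g(ζ) - ζ is L(e^ζ), and e^ζ stays in a compact disk of radius 1/e.
  · have hsub : closedBall (0 : ℂ) (Real.exp (-1)) ⊆ ball 0 1 :=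
      closedBall_subset_ball (Real.exp_zero ▸ Real.exp_lt_exp.2 (by norm_num))
    obtain ⟨C, hC⟩ := (isCompact_closedBall (0 : ℂ) (Real.exp (-1))).exists_bound_of_continuousOn
      (hLd.continuousOn.mono hsub)
    refine ⟨C, fun x hx => ?_⟩
    have hxH : x ∈ H := by
      have : x.re < 0 := by linarith
      exact this
    rw [hgeq hxH, hg₀, ← Complex.sub_re, add_sub_cancel_left]
    refine (Complex.abs_re_le_norm _).trans (hC _ ?_)
    rw [mem_closedBall_zero_iff, Complex.norm_exp]
    exact Real.exp_le_exp.2 hx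
  · rw [hgeq hζ, hg₀e ζ hζ]

/-! ### The extension theorem -/

theorem mainTheorem7 (k : ℝ) (hk0 : 0 ≤ k) (hk1 : k < 1)
    (f : ℂ → ℂ) (hf : DifferentiableOn ℂ f (Metric.ball 0 1))
    (hf0 : f 0 = 0) (hf'0 : deriv f 0 ≠ 0)
    (c : ℂ) (r : ℝ) (hr : 0 ≤ r) (hB0 : (0 : ℂ) ∉ Metric.closedBall c r)
    (hBK : ∀ w ∈ Metric.closedBall c r, ∀ z ∈ Metric.closedBall c r,
      Real.sqrt ‖w / z‖ ≤ (1 + k) / (1 - k))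
    (hfB : ∀ z ∈ Metric.ball (0 : ℂ) 1, z ≠ 0 → z * deriv f z / f z ∈ Metric.closedBall c r) :
    ∃ F : OnePoint ℂ ≃ₜ OnePoint ℂ, IsKQuasiconformalSphere k F ∧
      F OnePoint.infty = OnePoint.infty ∧ ∀ z ∈ Metric.ball (0 : ℂ) 1, F (z : OnePoint ℂ) = (f z : OnePoint ℂ) := by
  obtain ⟨a, ha0, ha⟩ := exists_disk_center hk0 hk1 hr hB0 hBK
  obtain ⟨g, hg, hgf⟩ := exists_halfPlaneLift hk0 hf hf0 hf'0 hr hB0 ha0 ha hfB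
  have hG := hg.isQCLogLift_rayExtension hk0 hk1
  refine ⟨hG.homeomorph.onePointCongr, hG.isKQuasiconformalSphere, rfl, fun z hz => ?_⟩
  change ((expConj (rayExtension a g) z : ℂ) : OnePoint ℂ) = _
  congr 1
  by_cases hz0 : z = 0
  · rw [hz0, expConj_zero, hf0]
  · have hre : (Complex.log z).re < 0 := by
      rw [Complex.log_re]
      exact Real.log_neg (norm_pos_iff.2 hz0) (mem_ball_zero_iff.1 hz)
    rw [expConj_of_ne_zero _ hz0, rayExtension_of_le a g hre.le, hgf _ hre, Complex.exp_log hz0]
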